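/- Let $\mathbb G$ be a nontrivial homogeneous group, i.e. a connected, simply connected Lie group whose Lie algebra $\mathfrak g$ carries a family of dilations $\delta_r=\exp(A\log r)$, $r>0$, where $A$ is a diagonalisable linear operator on $\mathfrak g$ with positive eigenvalues and each $\delta_r$ is a morphism of Lie algebras; the induced automorphisms of $\mathbb G$ are also denoted by $\delta_r$, and $Q=\operatorname{Tr}A$ is the homogeneous dimension. Let $dx$ be a Haar measure on $\mathbb G$, let $0$ denote the identity element, and let $|\cdot|$ be a homogeneous quasi-norm, i.e. a continuous function $\mathbb G\to[0,\infty)$ with $|x^{-1}|=|x|$, $|\delta_r x|=r|x|$ for $r>0$, and $|x|=0$ if and only if $x=0$. Write $B(0,R)=\{y\in\mathbb G: |y|<R\}$, and let $\sigma$ be the area of the unit sphere $S=\{y\in\mathbb G: |y|=1\}$, i.e. the total mass of the measure $d\sigma$ on $S$ for which $\int_{\mathbb G}f(x)\,dx=\int_0^\infty\int_S f(\delta_r y)\,r^{Q-1}\,d\sigma(y)\,dr$ for all integrable $f$. Let $1<p\le q<\infty$, $\frac1p+\frac1{p'}=1$, and $\alpha,\beta\in\mathbb R$. Then there is a constant $C\in[0,\infty)$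 such that the inequality $$\left(\int_{\mathbb G}\left(\int_{B(0,|x|)}|f(y)|\,dy\right)^q|x|^\alpha\,dx\right)^{\frac1q}\le C\left(\int_{\mathbb G}|f(x)|^p\,|x|^\beta\,dx\right)^{\frac1p}$$ holds for all measurable functions $f:\mathbb G\to\mathbb C$ if and only if $$\alpha+Q<0,\qquad \beta(1-p')+Q>0\qquad\text{and}\qquad \frac{\alpha+Q}{q}+\frac{\beta(1-p')+Q}{p'}=0.$$ Moreover, under these conditions there is a smallest constant $C$ for which the inequality holds for all measurable $f$, and it satisfies $$\frac{\sigma^{\frac1q+\frac1{p'}}}{|\alpha+Q|^{\frac1q}\,(\beta(1-p')+Q)^{\frac1{p'}}}\le C\le (p')^{\frac1{p'}}\,p^{\frac1q}\,\frac{\sigma^{\frac1q+\frac1{p'}}}{|\alpha+Q|^{\frac1q}\,(\beta(1-p')+Q)^{\frac1{p'}}}.$$ -/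

import Mathlib

open MeasureTheory Set
open scoped Manifold ContDiff ENNReal

noncomputable section

/-- A family of dilations on a Lie group `G` modelled on the finite-dimensional real vector space
`E`. The dilations of the Lie algebra `𝔤` of `G` are `δ_r = exp (A log r)`, `r > 0`, where `A` is
a diagonalisable linear operator on `𝔤` with positive eigenvalues; they are written here in a basis
of eigenvectors of `A` (`basis`), with eigenvalues `weight`, so that
`δ_r (basis i) = r ^ (weight i) • basis i`. Each `δ_r` is a morphism of Lie algebras, and
`dil r : G ≃* G` is the automorphism of `G` with differential `δ_r` at the identity.
When `G` is connected and simply connected, such an automorphism exists and is unique. -/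
structure GroupDilations (E : Type*) [NormedAddCommGroup E] [NormedSpace ℝ E]
    (G : Type*) [TopologicalSpace G] [ChartedSpace E G] [Group G] where
  /-- a basis of the Lie algebra made of eigenvectors of `A` -/
  basis : Module.Basis (Fin (Module.finrank ℝ E)) ℝ (GroupLieAlgebra 𝓘(ℝ, E) G)
  /-- the eigenvalues of `A` (the weights of the dilations) -/
  weight : Fin (Module.finrank ℝ E) → ℝ
  weight_pos : ∀ i, 0 < weight i
  /-- the dilations of the Lie algebra -/
  lieDil : ℝ → GroupLieAlgebra 𝓘(ℝ, E) G →ₗ[ℝ] GroupLieAlgebra 𝓘(ℝ, E) G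
  lieDil_basis : ∀ r : ℝ, 0 < r → ∀ i, lieDil r (basis i) = r ^ weight i • basis i
  lieDil_bracket : ∀ r : ℝ, 0 < r → ∀ X Y : GroupLieAlgebra 𝓘(ℝ, E) G,
    lieDil r ⁅X, Y⁆ = ⁅lieDil r X, lieDil r Y⁆
  /-- the dilations of the group (only the values at `r > 0` matter) -/
  dil : ℝ → G ≃* G
  contMDiff_dil : ∀ r : ℝ, 0 < r → ContMDiff 𝓘(ℝ, E) 𝓘(ℝ, E) ∞ (dil r)
  /-- The two sides are vectors tangent to `G` at `dil r 1` and at `1`, which are the same point;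
  they are compared in the model space `E`, of which both tangent spaces are copies. -/
  mfderiv_dil : ∀ r : ℝ, 0 < r → ∀ X : GroupLieAlgebra 𝓘(ℝ, E) G,
    (mfderiv 𝓘(ℝ, E) 𝓘(ℝ, E) (dil r) 1 X : E) = (lieDil r X : E)

namespace GroupDilations

variable {E : Type*} [NormedAddCommGroup E] [NormedSpace ℝ E]
  {G : Type*} [TopologicalSpace G] [ChartedSpace E G] [Group G]

/-- The homogeneous dimension `Q = Tr A`, the sum of the weights. -/
def homDim (D : GroupDilations E G) : ℝ := ∑ i, D.weight i

/-- Homogeneous quasi-norms: continuous, nonnegative, symmetric, homogeneous of degree one with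
respect to the dilations, and vanishing exactly at the identity. -/
structure IsQuasiNorm (D : GroupDilations E G) (N : G → ℝ) : Prop where
  continuous : Continuous N
  nonneg : ∀ x, 0 ≤ N x
  inv : ∀ x, N x⁻¹ = N x
  dil : ∀ r : ℝ, 0 < r → ∀ x, N (D.dil r x) = r * N x
  eq_zero_iff : ∀ x, N x = 0 ↔ x = 1

/-- The surface measure on the unit sphere `{x | N x = 1}` that belongs to the Haar measure `μ` and
to the dilations: `σ(T) = Q μ {δ_r y | 0 < r < 1, y ∈ T}` for a subset `T` of the sphere, the same
normalisation as in `MeasureTheory.Measure.toSphere`. It is the measure in the polar decomposition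
`∫ f dμ = ∫₀^∞ ∫ f(δ_r y) r^(Q-1) dσ(y) dr`. -/
def surfaceMeasure [MeasurableSpace G] (D : GroupDilations E G) (μ : Measure G) (T : Set G) :
    ℝ≥0∞ :=
  ENNReal.ofReal D.homDim * μ {x | ∃ r ∈ Ioo (0 : ℝ) 1, ∃ y ∈ T, x = D.dil r y}

/-- The area of the unit sphere with respect to the quasi-norm `N`. -/
def sphereArea [MeasurableSpace G] (D : GroupDilations E G) (μ : Measure G) (N : G → ℝ) : ℝ :=
  (D.surfaceMeasure μ {y | N y = 1}).toReal

end GroupDilations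

/-- The weighted integral Hardy inequality with weights `|x|^α`, `|x|^β` and constant `C` holds for
all measurable functions `f : G → ℂ`, where `|x| = N x` and the inner integral is over the ball
`B(0, |x|) = {y | N y < N x}`. All integrals are in `[0, ∞]`. -/
def HardyInequality {G : Type*} [MeasurableSpace G] (μ : Measure G) (N : G → ℝ)
    (p q α β C : ℝ) : Prop :=
  ∀ f : G → ℂ, Measurable f →
    (∫⁻ x, (∫⁻ y in {y | N y < N x}, ‖f y‖ₑ ∂μ) ^ q * ENNReal.ofReal (N x ^ α) ∂μ) ^ (1 / q)
      ≤ ENNReal.ofReal C * (∫⁻ x, ‖f x‖ₑ ^ p * ENNReal.ofReal (N x ^ β) ∂μ) ^ (1 / p)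

end

/-! Geometry enters only through one scaling fact: `{N < r}` has Haar measure `r ^ Q` times that of
the unit ball, and the latter is positive and finite. Near the identity, Haar measure is comparable
with Lebesgue measure in a chart (`exists_haar_comparable_chart`). For `r < 1` the dilation is a
contracting automorphism whose derivative at the identity is diagonal with determinant `r ^ Q`.
Comparing both measures along the iterates of a small neighbourhood, the comparison constants are
lost as the number of iterations grows, so the modulus is exactly `r ^ Q`
(`haar_image_contracting_automorphism`). Small sublevel sets of `N` lie in compact sets, which gives
finiteness. Hence `N` pushes Haar measure forward to `σ r ^ (Q - 1) dr` on `(0, ∞)`, and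
`IsRadialGauge` is all that the rest uses.

Sufficiency is Muckenhoupt's argument. Put `B = β(1 - p') + Q` and `A = |α + Q|`. Hölder's
inequality on the ball, with a suitable power of `|y|` inserted, bounds the inner integral.
Minkowski's inequality with exponent `q / p ≥ 1` interchanges the integrals. What remains are
integrals of powers over balls and their complements, and the balance condition `B / p' = A / q`
makes the exponents match.

For necessity, test with `|x| ^ (β(1 - p'))` truncated to the ball of radius `R`. The product of the
integral of `|x| ^ (β(1 - p'))` over the ball, to the power `1 / p'`, and that of `|x| ^ α` over the
complement, to the power `1 / q`, is then at most `C` for every `R`. Finiteness of both factors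
gives the sign conditions, independence of `R` the balance, and `R = 1` the lower bound. -/

open Filter Topology NNReal Pointwise

/-! ### Haar measure against Lebesgue measure in a chart. -/

section HaarChart

variable {F : Type*} [NormedAddCommGroup F] [NormedSpace ℝ F]
  {G : Type*} [TopologicalSpace G] [Group G]

/-- Multiplication has identity derivative in its first variable at `(1, 1)`. Strict
differentiability makes the approximation uniform over all right translations by `x` near `1`. -/
lemma exists_nhds_approximatesLinearOn_mul_right [IsTopologicalGroup G]
    (e : OpenPartialHomeomorph G F) (h1 : (1 : G) ∈ e.source) {L : F × F →L[ℝ] F}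
    (hL : ∀ v, L (v, 0) = v)
    (hτ : HasStrictFDerivAt (fun z : F × F ↦ e (e.symm z.1 * e.symm z.2)) L (e 1, e 1))
    {δ : ℝ≥0} (hδ : 0 < δ) :
    ∃ V ∈ 𝓝 (1 : G), V ⊆ e.source ∧ ∃ W ∈ 𝓝 (1 : G), ∀ x ∈ W,
      ApproximatesLinearOn (fun a ↦ e (e.symm a * x)) (ContinuousLinearMap.id ℝ F) (e '' V) δ := by
  obtain ⟨s, hs, happ⟩ := hτ.approximates_deriv_on_nhds (Or.inr hδ)
  rw [nhds_prod_eq, mem_prod_iff] at hs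
  obtain ⟨V, hV, W, hW, hVW⟩ := hs
  have hc := e.continuousAt h1
  have hsrc : e.source ∈ 𝓝 (1 : G) := e.open_source.mem_nhds h1
  refine ⟨e ⁻¹' V ∩ e.source, inter_mem (hc hV) hsrc, inter_subset_right,
    e ⁻¹' W ∩ e.source, inter_mem (hc hW) hsrc, ?_⟩
  rintro x ⟨hxW, hxs⟩ _ ⟨a, ⟨haV, has⟩, rfl⟩ _ ⟨b, ⟨hbV, hbs⟩, rfl⟩
  have := happ (e a, e x) (hVW ⟨haV, hxW⟩) (e b, e x) (hVW ⟨hbV, hxW⟩)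
  simpa [e.left_inv has, e.left_inv hbs, e.left_inv hxs, hL, Prod.norm_mk] using this

variable [MeasurableSpace F] [BorelSpace F] [MeasurableSpace G] [BorelSpace G]

omit [NormedSpace ℝ F] [Group G] in
lemma OpenPartialHomeomorph.measurableSet_image (e : OpenPartialHomeomorph G F) {A : Set G}
    (hA : MeasurableSet A) (hAs : A ⊆ e.source) : MeasurableSet (e '' A) := by
  classical
  rw [e.image_eq_target_inter_inv_preimage hAs]
  -- `e.symm` is controlled only on the target, so it is made globally measurable by a constant
  -- value outside.
  have := (e.continuousOn_symm.measurable_piecewise (f := e.symm) (s := e.target)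
    (g := fun _ ↦ (e.symm (Classical.arbitrary F))) continuousOn_const e.open_target.measurableSet) hA
  convert this.inter e.open_target.measurableSet using 1
  ext x
  by_cases hx : x ∈ e.target <;> simp [hx]

omit [NormedSpace ℝ F] in
/-- Fubini for the action of `G` by translations on a neighbourhood that carries a measure coming
from a chart. -/
lemma haar_mul_chart_measure [IsTopologicalGroup G] [SecondCountableTopology G]
    (μ : Measure G) [SFinite μ] [μ.IsMulLeftInvariant] (ν : Measure F)
    (e : OpenPartialHomeomorph G F) {U : Set G} (hU : MeasurableSet U) (hUs : U ⊆ e.source)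
    (hfin : ν (e '' U) ≠ ⊤) {A : Set G} (hA : MeasurableSet A) :
    μ A * ν (e '' U) = ∫⁻ x, ν (e '' ({y | y * x ∈ A} ∩ U)) ∂μ := by
  have heU := e.measurableSet_image hU hUs
  have hsub : e '' U ⊆ e.target := by
    rw [e.image_eq_target_inter_inv_preimage hUs]; exact inter_subset_left
  have hae : AEMeasurable e.symm (ν.restrict (e '' U)) :=
    (e.continuousOn_symm.mono hsub).aemeasurable heU
  have : IsFiniteMeasure (ν.restrict (e '' U)) := ⟨by simpa using hfin.lt_top⟩
  set ρ := (ν.restrict (e '' U)).map e.symm with hρ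
  have hρB : ∀ B, MeasurableSet B → ρ B = ν (e '' (B ∩ U)) := by
    intro B hB
    rw [hρ, Measure.map_apply_of_aemeasurable hae hB, Measure.restrict_apply' heU]
    congr 1
    ext z
    constructor
    · rintro ⟨hz, u, hu, rfl⟩
      rw [mem_preimage, e.left_inv (hUs hu)] at hz
      exact ⟨u, ⟨hz, hu⟩, rfl⟩
    · rintro ⟨u, ⟨hz, hu⟩, rfl⟩
      exact ⟨by rwa [mem_preimage, e.left_inv (hUs hu)], u, hu, rfl⟩
  -- The set `{(y, x) | y * x ∈ A}` is measured in two orders: for fixed `y`, left invariance gives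
  -- `μ A`; for fixed `x`, the slice is measured in the chart.
  have hS : MeasurableSet {z : G × G | z.1 * z.2 ∈ A} := measurable_mul hA
  have h1 := Measure.prod_apply (μ := ρ) (ν := μ) hS
  rw [Measure.prod_apply_symm hS] at h1
  have h2 : ∀ y : G, μ (Prod.mk y ⁻¹' {z : G × G | z.1 * z.2 ∈ A}) = μ A := fun y ↦
    measure_preimage_mul μ y A
  have h3 : ρ univ = ν (e '' U) := by rw [hρB _ MeasurableSet.univ, univ_inter]
  simp only [h2, lintegral_const, h3] at h1
  rw [← h1]
  refine lintegral_congr fun x ↦ ?_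
  exact hρB _ (measurable_mul_const x hA)

/-- Near the identity, a left Haar measure is comparable with the Lebesgue measure in a chart in
which the multiplication is strictly differentiable. -/
theorem exists_haar_comparable_chart [FiniteDimensional ℝ F] [IsTopologicalGroup G]
    [SecondCountableTopology G] [LocallyCompactSpace G]
    (μ : Measure G) [μ.IsHaarMeasure] (ν : Measure F) [ν.IsAddHaarMeasure]
    (e : OpenPartialHomeomorph G F) (h1 : (1 : G) ∈ e.source) {L : F × F →L[ℝ] F}
    (hL : ∀ v, L (v, 0) = v)
    (hτ : HasStrictFDerivAt (fun z : F × F ↦ e (e.symm z.1 * e.symm z.2)) L (e 1, e 1)) :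
    ∃ U ∈ 𝓝 (1 : G), U ⊆ e.source ∧ ∃ c C : ℝ≥0∞, c ≠ 0 ∧ C ≠ ⊤ ∧
      ∀ A ⊆ U, MeasurableSet A → c * ν (e '' A) ≤ μ A ∧ μ A ≤ C * ν (e '' A) := by
  have hid : ENNReal.ofReal |(ContinuousLinearMap.id ℝ F).det| = 1 := by
    simp [ContinuousLinearMap.det]
  have hup := addHaar_image_le_mul_of_det_lt ν (ContinuousLinearMap.id ℝ F) (m := 2)
    (by rw [hid]; norm_num)
  have hlo := mul_le_addHaar_image_of_lt_det ν (ContinuousLinearMap.id ℝ F) (m := 2⁻¹)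
    (by rw [hid]; norm_num)
  obtain ⟨δ, ⟨hδup, hδlo⟩, hδ⟩ := ((hup.and hlo).and self_mem_nhdsWithin).exists
  obtain ⟨V, hV, hVs, W, hW, happ⟩ := exists_nhds_approximatesLinearOn_mul_right e h1 hL hτ hδ
  obtain ⟨K, hK, hKW, hKc⟩ := local_compact_nhds hW
  obtain ⟨K', hK', hKV, hKc'⟩ := local_compact_nhds hV
  have hdiv : Tendsto (fun z : G × G ↦ z.1⁻¹ * z.2) (𝓝 (1, 1)) (𝓝 1) := by
    have : Continuous fun z : G × G ↦ z.1⁻¹ * z.2 := by fun_prop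
    simpa using this.tendsto (1, 1)
  have := hdiv hK
  rw [nhds_prod_eq, mem_map, mem_prod_self_iff] at this
  obtain ⟨U₁, hU₁, hU₁K⟩ := this
  obtain ⟨U, hUsub, hUo, h1U⟩ := mem_nhds_iff.1 (inter_mem hU₁ hK')
  have hUV : U ⊆ V := fun x hx ↦ hKV (hUsub hx).2
  have hUs : U ⊆ e.source := hUV.trans hVs
  have hdiv' : Tendsto (fun z : G × G ↦ z.1 * z.2⁻¹) (𝓝 (1, 1)) (𝓝 1) := by
    have : Continuous fun z : G × G ↦ z.1 * z.2⁻¹ := by fun_prop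
    simpa using this.tendsto (1, 1)
  have := hdiv' (hUo.mem_nhds h1U)
  rw [nhds_prod_eq, mem_map, mem_prod_iff] at this
  obtain ⟨A₀, hA₀, X, hX, hAX⟩ := this
  have hfin : ν (e '' U) ≠ ⊤ := by
    have : IsCompact (e '' K') := hKc'.image_of_continuousOn (e.continuousOn.mono (hKV.trans hVs))
    exact ((measure_mono (image_mono fun x hx ↦ (hUsub hx).2)).trans_lt this.measure_lt_top).ne
  have hopen : IsOpen (e '' U) := e.isOpen_image_of_subset_source hUo hUs
  have hpos : ν (e '' U) ≠ 0 := (hopen.measure_pos ν ⟨e 1, 1, h1U, rfl⟩).ne'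
  obtain ⟨X', hX'sub, hX'o, h1X'⟩ := mem_nhds_iff.1 (inter_mem hX hW)
  -- Right translation by `x`, read in the chart, carries the slice over `x` onto `A ∩ U x`.
  have himg : ∀ (A : Set G) (x : G), (fun a ↦ e (e.symm a * x)) '' (e '' ({y | y * x ∈ A} ∩ U))
      = e '' (A ∩ (fun y ↦ y * x) '' U) := by
    intro A x
    ext z
    constructor
    · rintro ⟨_, ⟨y, ⟨hy, hyU⟩, rfl⟩, rfl⟩
      refine ⟨y * x, ⟨hy, y, hyU, rfl⟩, ?_⟩
      simp [e.left_inv (hUs hyU)]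
    · rintro ⟨_, ⟨hy, y, hyU, rfl⟩, rfl⟩
      refine ⟨e y, ⟨y, ⟨hy, hyU⟩, rfl⟩, ?_⟩
      simp [e.left_inv (hUs hyU)]
  refine ⟨A₀ ∩ U, inter_mem hA₀ (hUo.mem_nhds h1U), inter_subset_right.trans hUs,
    2⁻¹ * μ X' / ν (e '' U), 2 * μ K / ν (e '' U), ?_, ?_, ?_⟩
  · have : μ X' ≠ 0 := (hX'o.measure_pos μ ⟨1, h1X'⟩).ne'
    exact (ENNReal.div_pos (by simpa using this) hfin).ne'
  · exact ENNReal.div_ne_top (ENNReal.mul_ne_top (by simp) hKc.measure_lt_top.ne) hpos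
  intro A hAsub hA
  have hF := haar_mul_chart_measure μ ν e hUo.measurableSet hUs hfin hA
  constructor
  · rw [← ENNReal.mul_div_right_comm, ENNReal.div_le_iff hpos hfin, hF]
    -- For `x` in `X'` the translate `U x` contains all of `A`, and translating the slice onto `A`
    -- at most doubles its volume.
    calc 2⁻¹ * μ X' * ν (e '' A) = ∫⁻ _ in X', 2⁻¹ * ν (e '' A) ∂μ := by
          rw [setLIntegral_const]; ring
      _ ≤ ∫⁻ x in X', ν (e '' ({y | y * x ∈ A} ∩ U)) ∂μ := by
          refine setLIntegral_mono' hX'o.measurableSet fun x hx ↦ ?_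
          have h := hδup _ _ ((happ x (hX'sub hx).2).mono_set
            (image_mono (inter_subset_right.trans hUV) : e '' ({y | y * x ∈ A} ∩ U) ⊆ e '' V))
          have hA' : A ∩ (fun y ↦ y * x) '' U = A := by
            refine inter_eq_left.2 fun a ha ↦ ⟨a * x⁻¹, ?_, by simp⟩
            exact hAX (a := (a, x)) ⟨(hAsub ha).1, (hX'sub hx).1⟩
          rw [himg, hA'] at h
          rw [mul_comm, ← div_eq_mul_inv]
          exact ENNReal.div_le_of_le_mul' h
      _ ≤ _ := setLIntegral_le_lintegral _ _
  · rw [← ENNReal.mul_div_right_comm, ENNReal.le_div_iff_mul_le (Or.inl hpos) (Or.inl hfin), hF]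
    -- A nonempty slice forces `x ∈ U⁻¹ A ⊆ K`; for such `x`, translating the slice into `A` at most
    -- halves its volume.
    calc ∫⁻ x, ν (e '' ({y | y * x ∈ A} ∩ U)) ∂μ
        ≤ ∫⁻ x, K.indicator (fun _ ↦ 2 * ν (e '' A)) x ∂μ := by
          refine lintegral_mono fun x ↦ ?_
          by_cases hx : x ∈ K
          · have h := hδlo _ _ ((happ x (hKW hx)).mono_set
              (image_mono (inter_subset_right.trans hUV) : e '' ({y | y * x ∈ A} ∩ U) ⊆ e '' V))
            rw [himg] at h
            rw [indicator_of_mem hx]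
            replace h := h.trans (measure_mono (image_mono inter_subset_left))
            rw [ENNReal.coe_inv (by norm_num), mul_comm, ← div_eq_mul_inv] at h
            simpa [mul_comm] using (ENNReal.div_le_iff_le_mul (by simp) (by simp)).1 h
          · have : {y | y * x ∈ A} ∩ U = ∅ := by
              rw [eq_empty_iff_forall_notMem]
              rintro y ⟨hy, hyU⟩
              apply hx
              have : (y, y * x) ∈ U₁ ×ˢ U₁ := ⟨(hUsub hyU).1, (hUsub (hAsub hy).2).1⟩
              simpa using hU₁K this
            simp [this]
      _ ≤ 2 * ν (e '' A) * μ K := lintegral_indicator_const_le _ _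
      _ = _ := by ring

end HaarChart

/-! ### Contracting automorphisms and their Haar modulus. -/

/-- If `x < y`, then `(x / y) ^ k` tends to `0` and beats any constants. This is how comparison
constants disappear under iteration. -/
lemma le_of_forall_mul_pow_le {a b x y : ℝ} (ha : 0 < a) (hx : 0 ≤ x)
    (h : ∀ k : ℕ, a * y ^ k ≤ b * x ^ k) : y ≤ x := by
  by_contra! hxy
  have hy : 0 < y := hx.trans_lt hxy
  have hlim : Tendsto (fun k : ℕ ↦ b * (x / y) ^ k) atTop (𝓝 (b * 0)) :=
    (tendsto_pow_atTop_nhds_zero_of_lt_one (by positivity) ((div_lt_one hy).2 hxy)).const_mul b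
  rw [mul_zero] at hlim
  refine absurd (ge_of_tendsto' hlim fun k ↦ ?_ : a ≤ 0) (not_le.2 ha)
  rw [div_pow, ← mul_div_assoc, le_div_iff₀ (by positivity)]
  exact h k

lemma MeasurableEmbedding.iterate {X : Type*} [MeasurableSpace X] {f : X → X}
    (hf : MeasurableEmbedding f) (k : ℕ) : MeasurableEmbedding f^[k] := by
  induction k with
  | zero => exact MeasurableEmbedding.id
  | succ k ih => rw [Function.iterate_succ]; exact ih.comp hf

section Contraction

variable {F : Type*} [NormedAddCommGroup F] [NormedSpace ℝ F]
  {G : Type*} [TopologicalSpace G] [Group G]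

/-- An automorphism whose derivative at `1` is a strict contraction maps arbitrarily small
neighbourhoods of `1` into themselves and contracts them to `1`. -/
lemma exists_contracting_nhds (e : OpenPartialHomeomorph G F) (h1 : (1 : G) ∈ e.source)
    (φ : G ≃ₜ* G) {T : F →L[ℝ] F} (hT : ‖T‖ < 1)
    (hφ : HasStrictFDerivAt (fun z ↦ e (φ (e.symm z))) T (e 1)) {δ : ℝ≥0} (hδ : 0 < δ)
    {U : Set G} (hU : U ∈ 𝓝 1) :
    ∃ V, IsOpen V ∧ 1 ∈ V ∧ V ⊆ U ∧ V ⊆ e.source ∧ MapsTo φ V V ∧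
      (∀ x ∈ V, Tendsto (fun k ↦ φ^[k] x) atTop (𝓝 1)) ∧
      ApproximatesLinearOn (fun z ↦ e (φ (e.symm z))) T (e '' V) δ := by
  set g : F → F := fun z ↦ e (φ (e.symm z)) with hg
  have hg1 : g (e 1) = e 1 := by simp [hg, e.left_inv h1]
  -- The slack `η` absorbs the nonlinear error while keeping the contraction factor `‖T‖ + η` below
  -- `1`.
  obtain ⟨η, hη0, hη⟩ : ∃ η : ℝ≥0, 0 < η ∧ ‖T‖ + η < 1 :=
    ⟨((1 - ‖T‖) / 2).toNNReal, Real.toNNReal_pos.2 (by linarith),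
      by rw [Real.coe_toNNReal _ (by linarith)]; linarith⟩
  obtain ⟨s, hs, happ⟩ := hφ.approximates_deriv_on_nhds (Or.inr (lt_min hδ hη0))
  have hsymm : Tendsto e.symm (𝓝 (e 1)) (𝓝 1) := e.tendsto_symm h1
  have hsrc : e.source ∈ 𝓝 (1 : G) := e.open_source.mem_nhds h1
  have hφ1 : Tendsto φ (𝓝 1) (𝓝 1) := by
    simpa using (map_continuous φ).tendsto 1
  have ht : s ∩ e.target ∩ e.symm ⁻¹' (φ ⁻¹' e.source ∩ U) ∈ 𝓝 (e 1) :=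
    inter_mem (inter_mem hs (e.open_target.mem_nhds (e.map_source h1)))
      (hsymm (inter_mem (hφ1 hsrc) hU))
  obtain ⟨ρ, hρ, hball⟩ := Metric.mem_nhds_iff.1 ht
  set κ : ℝ := ‖T‖ + η with hκ
  have hκ0 : 0 ≤ κ := by positivity
  -- A ball in the chart is invariant because `φ` brings points closer to its centre.
  set V := e.source ∩ e ⁻¹' Metric.ball (e 1) ρ with hV
  have hVb : ∀ x ∈ V, e x ∈ s ∧ φ x ∈ e.source ∧ x ∈ U := by
    rintro x ⟨hx, hxb⟩
    obtain ⟨⟨h1, -⟩, h2, h3⟩ := hball hxb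
    rw [e.left_inv hx] at h2 h3
    exact ⟨h1, h2, h3⟩
  have h1V : (1 : G) ∈ V := ⟨h1, Metric.mem_ball_self hρ⟩
  have hstep : ∀ x ∈ V, ‖e (φ x) - e 1‖ ≤ κ * ‖e x - e 1‖ := by
    intro x hx
    have h := happ (e x) (hVb x hx).1 (e 1) (hVb 1 h1V).1
    have hgx : g (e x) = e (φ x) := by simp [hg, e.left_inv hx.1]
    change ‖g (e x) - g (e 1) - T (e x - e 1)‖ ≤ _ at h
    rw [hg1, hgx] at h
    have h2 : (((min δ η : ℝ≥0)) : ℝ) ≤ η := by exact_mod_cast min_le_right _ _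
    calc ‖e (φ x) - e 1‖ = ‖(e (φ x) - e 1 - T (e x - e 1)) + T (e x - e 1)‖ := by
          rw [sub_add_cancel]
      _ ≤ η * ‖e x - e 1‖ + ‖T‖ * ‖e x - e 1‖ :=
          (norm_add_le _ _).trans (add_le_add (h.trans (by gcongr)) (T.le_opNorm _))
      _ = κ * ‖e x - e 1‖ := by rw [hκ]; ring
  have hmaps : MapsTo φ V V := by
    intro x hx
    refine ⟨(hVb x hx).2.1, ?_⟩
    have h := hstep x hx
    have hxb : ‖e x - e 1‖ < ρ := by simpa [dist_eq_norm] using hx.2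
    rw [mem_preimage, Metric.mem_ball, dist_eq_norm]
    exact (h.trans (mul_le_of_le_one_left (norm_nonneg _) hη.le)).trans_lt hxb
  refine ⟨V, e.isOpen_inter_preimage Metric.isOpen_ball, h1V, fun x hx ↦ (hVb x hx).2.2,
    inter_subset_left, hmaps, ?_, ?_⟩
  · intro x hx
    have hmem : ∀ k, φ^[k] x ∈ V := fun k ↦ hmaps.iterate k hx
    have hbd : ∀ k, ‖e (φ^[k] x) - e 1‖ ≤ κ ^ k * ‖e x - e 1‖ := by
      intro k
      induction k with
      | zero => simp
      | succ k ih =>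
        rw [Function.iterate_succ_apply', pow_succ']
        refine (hstep _ (hmem k)).trans ?_
        rw [mul_assoc]
        gcongr
    have hlim : Tendsto (fun k ↦ e (φ^[k] x)) atTop (𝓝 (e 1)) := by
      rw [tendsto_iff_norm_sub_tendsto_zero]
      have h0 := (tendsto_pow_atTop_nhds_zero_of_lt_one hκ0 hη).mul_const ‖e x - e 1‖
      rw [zero_mul] at h0
      exact squeeze_zero (fun _ ↦ norm_nonneg _) hbd h0
    refine (hsymm.comp hlim).congr fun k ↦ ?_
    exact e.left_inv (hmem k).1
  · have : e '' V ⊆ s := by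
      rintro _ ⟨x, hx, rfl⟩
      exact (hVb x hx).1
    exact (happ.mono_set this).mono_num (min_le_left _ _)

/-- On a connected group, iterates of such an automorphism converge to `1` everywhere. -/
lemma tendsto_iterate_of_nhds [IsTopologicalGroup G] [ConnectedSpace G] (φ : G ≃ₜ* G)
    {V : Set G} (hV : V ∈ 𝓝 1) (h : ∀ x ∈ V, Tendsto (fun k ↦ φ^[k] x) atTop (𝓝 1)) (x : G) :
    Tendsto (fun k ↦ φ^[k] x) atTop (𝓝 1) := by
  have hmul : ∀ (k : ℕ) (a b : G), φ^[k] (a * b) = φ^[k] a * φ^[k] b := fun k a b ↦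
    iterate_map_mul φ k a b
  have hinv : ∀ (k : ℕ) (a : G), φ^[k] a⁻¹ = (φ^[k] a)⁻¹ := fun k a ↦ iterate_map_inv φ k a
  -- The points attracted to `1` form a subgroup; it is open, hence closed, hence everything by
  -- connectedness.
  let H : Subgroup G :=
    { carrier := {x | Tendsto (fun k ↦ φ^[k] x) atTop (𝓝 1)}
      mul_mem' := fun {a b} ha hb ↦ by
        have := Tendsto.mul ha hb
        simpa [hmul] using this
      one_mem' := by simp [iterate_map_one, tendsto_const_nhds]
      inv_mem' := fun {a} ha ↦ by
        have := Tendsto.inv ha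
        simpa [hinv] using this }
  have hopen : IsOpen (H : Set G) := H.isOpen_of_mem_nhds (g := 1) (mem_of_superset hV h)
  have huniv : (H : Set G) = univ :=
    IsClopen.eq_univ ⟨H.isClosed_of_isOpen hopen, hopen⟩ ⟨1, H.one_mem⟩
  exact (huniv ▸ mem_univ x : x ∈ (H : Set G))

/-- Sublevel sets of a function that is homogeneous under a contracting automorphism form a
neighbourhood basis of `1`. -/
lemma exists_sublevel_subset [T2Space G] [LocallyCompactSpace G] (φ : G ≃ₜ* G)
    (hlim : ∀ x, Tendsto (fun k ↦ φ^[k] x) atTop (𝓝 1))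
    (hsmall : ∀ U ∈ 𝓝 (1 : G), ∃ V, IsOpen V ∧ 1 ∈ V ∧ V ⊆ U ∧ MapsTo φ V V)
    {N : G → ℝ} (hN : Continuous N) (hN0 : ∀ x, 0 ≤ N x) (hN1 : ∀ x, N x = 0 → x = 1)
    {ρ : ℝ} (hρ1 : ρ ≤ 1) (hNφ : ∀ x, N (φ x) = ρ * N x)
    {U : Set G} (hU : U ∈ 𝓝 1) :
    ∃ c : ℝ, 0 < c ∧ {x | N x < c} ⊆ U := by
  obtain ⟨K, hK, hKU, hKc⟩ := local_compact_nhds hU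
  obtain ⟨V, hVo, h1V, hVK, hmaps⟩ := hsmall K hK
  -- Any orbit entering `V` from outside has its last outside point in this compact shell. The shell
  -- omits `1`, so `N` is bounded below on it, while `N` does not increase along orbits.
  have hcomp : IsCompact ((φ ⁻¹' K) \ V) := by
    have : IsCompact (φ ⁻¹' K) := φ.toHomeomorph.isCompact_preimage.2 hKc
    exact this.diff hVo
  obtain ⟨c, hc, hcN⟩ : ∃ c : ℝ, 0 < c ∧ ∀ y ∈ (φ ⁻¹' K) \ V, c ≤ N y := by
    rcases ((φ ⁻¹' K) \ V).eq_empty_or_nonempty with hemp | hne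
    · exact ⟨1, one_pos, by simp [hemp]⟩
    · obtain ⟨y, hy, hmin⟩ := hcomp.exists_isMinOn hne hN.continuousOn
      refine ⟨N y, (hN0 y).lt_of_ne fun h ↦ hy.2 ?_, fun z hz ↦ hmin hz⟩
      rw [hN1 y h.symm]; exact h1V
  refine ⟨c, hc, fun x hx ↦ hKU (hVK ?_)⟩
  by_contra hxV
  have hex : ∃ k, φ^[k] x ∈ V := ((hlim x).eventually (hVo.mem_nhds h1V)).exists
  classical
  have hfind := Nat.find_spec hex
  have hpos : 0 < Nat.find hex := by
    rw [Nat.find_pos]; simpa using hxV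
  obtain ⟨k, hk⟩ := Nat.exists_eq_add_of_lt hpos
  rw [zero_add] at hk
  have hkV : φ^[k] x ∉ V := Nat.find_min hex (by omega)
  rw [hk, Function.iterate_succ_apply'] at hfind
  have h1 := hcN _ ⟨hVK hfind, hkV⟩
  have h2 : ∀ j, N (φ^[j] x) ≤ N x := by
    intro j
    induction j with
    | zero => simp
    | succ j ih =>
      rw [Function.iterate_succ_apply', hNφ]
      exact (mul_le_of_le_one_left (hN0 _) hρ1).trans ih
  exact absurd (h1.trans (h2 k)) (not_le.2 hx)

variable [MeasurableSpace F] [BorelSpace F] [MeasurableSpace G] [BorelSpace G]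

/-- The modulus of a contracting automorphism is the determinant of its derivative at `1`. -/
theorem haar_image_contracting_automorphism [FiniteDimensional ℝ F] [IsTopologicalGroup G]
    [T2Space G] [SecondCountableTopology G] [LocallyCompactSpace G]
    (μ : Measure G) [μ.IsHaarMeasure]
    (e : OpenPartialHomeomorph G F) (h1 : (1 : G) ∈ e.source) {L : F × F →L[ℝ] F}
    (hL : ∀ v, L (v, 0) = v)
    (hτ : HasStrictFDerivAt (fun z : F × F ↦ e (e.symm z.1 * e.symm z.2)) L (e 1, e 1))
    (φ : G ≃ₜ* G) {T : F →L[ℝ] F} (hT : ‖T‖ < 1)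
    (hφ : HasStrictFDerivAt (fun z ↦ e (φ (e.symm z))) T (e 1))
    {A : Set G} (hA : MeasurableSet A) :
    μ (φ '' A) = ENNReal.ofReal |T.det| * μ A := by
  set ν : Measure F := Measure.addHaar with hν
  obtain ⟨U, hU, hUs, c, C, hc, hC, hcomp⟩ := exists_haar_comparable_chart μ ν e h1 hL hτ
  -- Uniqueness of Haar measure provides some modulus `m`; only its value is left to find.
  set m := mulEquivHaarChar φ with hm
  have hmod : ∀ B : Set G, MeasurableSet B → μ (φ '' B) = m * μ B := by
    intro B hB
    have h := congrArg (fun ρ : Measure G ↦ ρ B) (mulEquivHaarChar_smul_eq_comap μ φ)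
    have hφm : MeasurableEmbedding φ := φ.toHomeomorph.measurableEmbedding
    simp only [Measure.smul_apply] at h
    rw [hφm.comap_apply] at h
    rw [← h, hm]; rfl
  have hiter : ∀ (k : ℕ) (B : Set G), MeasurableSet B → μ (φ^[k] '' B) = m ^ k * μ B := by
    intro k B hB
    induction k with
    | zero => simp
    | succ k ih =>
      have hmeas : MeasurableSet (φ^[k] '' B) :=
        (φ.toHomeomorph.measurableEmbedding.iterate k).measurableSet_image' hB
      rw [Function.iterate_succ', image_comp, hmod _ hmeas, ih, pow_succ']
      ring
  have key : ∀ δ : ℝ≥0, 0 < δ → ∃ V, IsOpen V ∧ V ⊆ U ∧ μ V ≠ 0 ∧ μ V ≠ ⊤ ∧ ν (e '' V) ≠ 0 ∧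
      ν (e '' V) ≠ ⊤ ∧ MapsTo φ V V ∧
      ApproximatesLinearOn (fun z ↦ e (φ (e.symm z))) T (e '' V) δ := by
    intro δ hδ
    obtain ⟨K, hK, hKU, hKc⟩ := local_compact_nhds hU
    obtain ⟨V, hVo, h1V, hVK, hVs, hmaps, -, happ⟩ :=
      exists_contracting_nhds e h1 φ hT hφ hδ hK
    have hcK : IsCompact (e '' K) :=
      hKc.image_of_continuousOn (e.continuousOn.mono (hKU.trans hUs))
    exact ⟨V, hVo, hVK.trans hKU, (hVo.measure_pos μ ⟨1, h1V⟩).ne',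
      ((measure_mono hVK).trans_lt hKc.measure_lt_top).ne,
      ((e.isOpen_image_of_subset_source hVo hVs).measure_pos ν ⟨e 1, 1, h1V, rfl⟩).ne',
      ((measure_mono (image_mono hVK)).trans_lt hcK.measure_lt_top).ne, hmaps, happ⟩
  have hstepimg : ∀ (V : Set G) (k : ℕ), V ⊆ U → MapsTo φ V V →
      e '' (φ^[k + 1] '' V) = (fun z ↦ e (φ (e.symm z))) '' (e '' (φ^[k] '' V)) := by
    intro V k hVU hmaps
    simp only [image_image]
    refine image_congr fun x hx ↦ ?_
    rw [Function.iterate_succ_apply', e.left_inv (hUs (hVU (hmaps.iterate k hx)))]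
  have hsub : ∀ (V : Set G) (k : ℕ), MapsTo φ V V → φ^[k] '' V ⊆ V := fun V k h ↦
    (h.iterate k).image_subset
  have hmeasim : ∀ (V : Set G) (k : ℕ), IsOpen V → MeasurableSet (φ^[k] '' V) := fun V k h ↦
    (φ.toHomeomorph.measurableEmbedding.iterate k).measurableSet_image' h.measurableSet
  -- For `d > |det T|`, each application of `φ` multiplies the chart volume of subsets of `V` by at
  -- most `d`. Comparability gives `m ^ k ≤ const * d ^ k` for all `k`, hence `m ≤ d`.
  have hle : ∀ d : ℝ≥0, ENNReal.ofReal |T.det| < d → m ≤ d := by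
    intro d hd
    obtain ⟨δ, hδ, hδ0⟩ :=
      ((addHaar_image_le_mul_of_det_lt ν T hd).and self_mem_nhdsWithin).exists
    obtain ⟨V, hVo, hVU, hV0, hVt, hν0, hνt, hmaps, happ⟩ := key δ hδ0
    have hk : ∀ k : ℕ, ν (e '' (φ^[k] '' V)) ≤ d ^ k * ν (e '' V) := by
      intro k
      induction k with
      | zero => simp
      | succ k ih =>
        rw [hstepimg V k hVU hmaps, pow_succ', mul_assoc]
        exact (hδ _ _ (happ.mono_set (image_mono (hsub V k hmaps)))).trans (by gcongr)
    have hfin : ∀ k : ℕ, (m : ℝ≥0∞) ^ k * μ V ≤ C * (d ^ k * ν (e '' V)) := by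
      intro k
      rw [← hiter k V hVo.measurableSet]
      exact (hcomp _ ((hsub V k hmaps).trans hVU) (hmeasim V k hVo)).2.trans (by gcongr; exact hk k)
    rw [← NNReal.coe_le_coe]
    refine le_of_forall_mul_pow_le (a := (μ V).toReal) (b := (C * ν (e '' V)).toReal)
      (ENNReal.toReal_pos hV0 hVt) d.2 fun k ↦ ?_
    have h := ENNReal.toReal_mono (ENNReal.mul_ne_top hC (ENNReal.mul_ne_top (by simp) hνt))
      (hfin k)
    simp only [ENNReal.toReal_mul, ENNReal.toReal_pow, ENNReal.coe_toReal] at h ⊢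
    linarith
  have hge : ∀ d : ℝ≥0, (d : ℝ≥0∞) < ENNReal.ofReal |T.det| → d ≤ m := by
    intro d hd
    obtain ⟨δ, hδ, hδ0⟩ :=
      ((mul_le_addHaar_image_of_lt_det ν T hd).and self_mem_nhdsWithin).exists
    obtain ⟨V, hVo, hVU, hV0, hVt, hν0, hνt, hmaps, happ⟩ := key δ hδ0
    have hk : ∀ k : ℕ, d ^ k * ν (e '' V) ≤ ν (e '' (φ^[k] '' V)) := by
      intro k
      induction k with
      | zero => simp
      | succ k ih =>
        rw [hstepimg V k hVU hmaps, pow_succ', mul_assoc]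
        refine le_trans ?_ (hδ _ _ (happ.mono_set (image_mono (hsub V k hmaps))))
        gcongr
    have hfin : ∀ k : ℕ, c * (d ^ k * ν (e '' V)) ≤ (m : ℝ≥0∞) ^ k * μ V := by
      intro k
      rw [← hiter k V hVo.measurableSet]
      refine le_trans ?_ (hcomp _ ((hsub V k hmaps).trans hVU) (hmeasim V k hVo)).1
      gcongr
      exact hk k
    -- The case `k = 0` excludes an infinite comparison constant, so the estimate can be read in
    -- `ℝ`.
    have hct : c ≠ ⊤ := by
      rintro rfl
      have := hfin 0
      simp only [pow_zero, one_mul, ENNReal.top_mul hν0, top_le_iff] at this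
      exact hVt this
    rw [← NNReal.coe_le_coe]
    refine le_of_forall_mul_pow_le (a := (c * ν (e '' V)).toReal) (b := (μ V).toReal)
      (ENNReal.toReal_pos (mul_ne_zero hc hν0) (ENNReal.mul_ne_top hct hνt)) m.2 fun k ↦ ?_
    have h := ENNReal.toReal_mono (ENNReal.mul_ne_top (by simp) hVt) (hfin k)
    simp only [ENNReal.toReal_mul, ENNReal.toReal_pow, ENNReal.coe_toReal] at h ⊢
    linarith
  have hmeq : (m : ℝ≥0∞) = ENNReal.ofReal |T.det| := by
    refine le_antisymm ?_ ?_
    · by_contra! hlt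
      obtain ⟨d, hd, hdm⟩ := ENNReal.lt_iff_exists_nnreal_btwn.1 hlt
      exact absurd (hle d hd) (not_le.2 (by exact_mod_cast hdm))
    · refine ENNReal.le_of_forall_nnreal_lt fun d hd ↦ ?_
      exact_mod_cast hge d hd
  rw [hmod A hA, hmeq]

end Contraction

/-! ### The multiplication and endomorphisms of a Lie group in a chart at the identity. -/

section LieChart

variable {E : Type*} [NormedAddCommGroup E] [NormedSpace ℝ E]
  {F : Type*} [NormedAddCommGroup F] [NormedSpace ℝ F]
  {G : Type*} [TopologicalSpace G] [ChartedSpace E G] [Group G]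

/-- The preferred chart at the identity, followed by a linear change of coordinates. -/
noncomputable def identityChart (G : Type*) [TopologicalSpace G] [ChartedSpace E G] [Group G] (L : E ≃L[ℝ] F) :
    OpenPartialHomeomorph G F :=
  (chartAt E (1 : G)).transHomeomorph L.toHomeomorph

lemma identityChart_apply (L : E ≃L[ℝ] F) (x : G) :
    identityChart G L x = L (chartAt E (1 : G) x) := rfl

lemma one_mem_identityChart_source (L : E ≃L[ℝ] F) : (1 : G) ∈ (identityChart G L).source :=
  mem_chart_source E 1

variable [LieGroup 𝓘(ℝ, E) ∞ G]

lemma contMDiffAt_identityChart (L : E ≃L[ℝ] F) :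
    ContMDiffAt 𝓘(ℝ, E) 𝓘(ℝ, F) ∞ (identityChart G L) 1 := by
  have h1 : ContMDiffAt 𝓘(ℝ, E) 𝓘(ℝ, E) ∞ (chartAt E (1 : G)) 1 :=
    contMDiffOn_chart.contMDiffAt ((chartAt E (1 : G)).open_source.mem_nhds (mem_chart_source E 1))
  exact (L.contDiff.contMDiff.contMDiffAt).comp (1 : G) h1

lemma contMDiffAt_identityChart_symm (L : E ≃L[ℝ] F) :
    ContMDiffAt 𝓘(ℝ, F) 𝓘(ℝ, E) ∞ (identityChart G L).symm (identityChart G L 1) := by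
  have h1 : ContMDiffAt 𝓘(ℝ, E) 𝓘(ℝ, E) ∞ (chartAt E (1 : G)).symm (chartAt E (1 : G) 1) :=
    contMDiffOn_chart_symm.contMDiffAt
      ((chartAt E (1 : G)).open_target.mem_nhds (mem_chart_target E 1))
  have h2 : L.symm (identityChart G L 1) = chartAt E (1 : G) 1 := by
    simp [identityChart_apply]
  refine ContMDiffAt.comp (identityChart G L 1) (I' := 𝓘(ℝ, E)) (g := (chartAt E (1 : G)).symm)
    (f := L.symm) ?_ (L.symm.contDiff.contMDiff.contMDiffAt)
  rw [h2]
  exact h1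

lemma exists_hasStrictFDerivAt_mul_identityChart (L : E ≃L[ℝ] F) :
    ∃ L' : F × F →L[ℝ] F, (∀ v, L' (v, 0) = v) ∧ HasStrictFDerivAt
      (fun z : F × F ↦ identityChart G L
        ((identityChart G L).symm z.1 * (identityChart G L).symm z.2)) L'
      (identityChart G L 1, identityChart G L 1) := by
  set e := identityChart G L with he
  have h1 : (1 : G) ∈ e.source := one_mem_identityChart_source L
  have hs := contMDiffAt_identityChart_symm (G := G) L
  rw [← he] at hs
  have hfst : ContMDiffAt 𝓘(ℝ, F × F) 𝓘(ℝ, E) ∞ (fun z : F × F ↦ e.symm z.1) (e 1, e 1) :=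
    ContMDiffAt.comp (e 1, e 1) (I' := 𝓘(ℝ, F)) (g := e.symm) (f := Prod.fst) hs
      contDiff_fst.contMDiff.contMDiffAt
  have hsnd : ContMDiffAt 𝓘(ℝ, F × F) 𝓘(ℝ, E) ∞ (fun z : F × F ↦ e.symm z.2) (e 1, e 1) :=
    ContMDiffAt.comp (e 1, e 1) (I' := 𝓘(ℝ, F)) (g := e.symm) (f := Prod.snd) hs
      contDiff_snd.contMDiff.contMDiffAt
  have hmul : ContMDiffAt 𝓘(ℝ, F × F) 𝓘(ℝ, F) ∞
      (fun z : F × F ↦ e (e.symm z.1 * e.symm z.2)) (e 1, e 1) := by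
    refine ContMDiffAt.comp (e 1, e 1) (I' := 𝓘(ℝ, E)) (g := e)
      (f := fun z : F × F ↦ e.symm z.1 * e.symm z.2) ?_ (hfst.mul hsnd)
    simp only [e.left_inv h1, mul_one]
    exact contMDiffAt_identityChart L
  have hstrict := (contMDiffAt_iff_contDiffAt.1 hmul).hasStrictFDerivAt (by simp)
  refine ⟨_, fun v ↦ ?_, hstrict⟩
  have hin : HasFDerivAt (fun a : F ↦ (a, e 1)) (ContinuousLinearMap.inl ℝ F F) (e 1) :=
    (hasFDerivAt_id (e 1)).prodMk (hasFDerivAt_const (e 1) (e 1))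
  have hcomp := HasFDerivAt.comp (e 1) (f := fun a : F ↦ (a, e 1))
    (g := fun z : F × F ↦ e (e.symm z.1 * e.symm z.2)) hstrict.hasFDerivAt hin
  -- Right multiplication by `1` is the identity, which determines the derivative on the first
  -- factor.
  have hid : HasFDerivAt ((fun z : F × F ↦ e (e.symm z.1 * e.symm z.2)) ∘ fun a : F ↦ (a, e 1))
      (ContinuousLinearMap.id ℝ F) (e 1) := by
    refine (hasFDerivAt_id (e 1)).congr_of_eventuallyEq ?_
    filter_upwards [e.open_target.mem_nhds (e.map_source h1)] with a ha
    simp [e.left_inv h1, e.right_inv ha]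
  have := congrArg (fun A : F →L[ℝ] F ↦ A v) (hcomp.unique hid)
  simpa using this

/-- The derivative of an endomorphism at `1` in the chart at the identity. -/
lemma hasStrictFDerivAt_identityChart (L : E ≃L[ℝ] F) (φ : G →* G)
    (hφ : ContMDiff 𝓘(ℝ, E) 𝓘(ℝ, E) ∞ φ) (M : E →L[ℝ] E)
    (hM : ∀ X : E, (mfderiv 𝓘(ℝ, E) 𝓘(ℝ, E) φ 1 X : E) = M X) :
    HasStrictFDerivAt (fun z ↦ identityChart G L (φ ((identityChart G L).symm z)))
      ((L : E →L[ℝ] F) ∘L M ∘L (L.symm : F →L[ℝ] E)) (identityChart G L 1) := by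
  set e := identityChart G L with he
  have h1 : (1 : G) ∈ e.source := one_mem_identityChart_source L
  have hs := contMDiffAt_identityChart_symm (G := G) L
  rw [← he] at hs
  have hsm : ContMDiffAt 𝓘(ℝ, F) 𝓘(ℝ, F) ∞ (fun z ↦ e (φ (e.symm z))) (e 1) := by
    refine ContMDiffAt.comp (e 1) (I' := 𝓘(ℝ, E)) (g := e) (f := fun z ↦ φ (e.symm z)) ?_
      (ContMDiffAt.comp (e 1) (I' := 𝓘(ℝ, E)) (g := φ) hφ.contMDiffAt hs)
    simp only [e.left_inv h1, map_one]
    exact contMDiffAt_identityChart L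
  have hstrict := (contMDiffAt_iff_contDiffAt.1 hsm).hasStrictFDerivAt (by simp)
  have hmd : HasMFDerivAt 𝓘(ℝ, E) 𝓘(ℝ, E) φ 1 (mfderiv 𝓘(ℝ, E) 𝓘(ℝ, E) φ 1) :=
    ((hφ.contMDiffAt (x := 1)).mdifferentiableAt (by simp)).hasMFDerivAt
  have hder := hmd.2
  -- Since `φ 1 = 1`, source and target use the same preferred chart.
  have hw : writtenInExtChartAt 𝓘(ℝ, E) 𝓘(ℝ, E) 1 φ
      = fun z ↦ chartAt E (1 : G) (φ ((chartAt E (1 : G)).symm z)) := by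
    ext z
    simp [writtenInExtChartAt, extChartAt, map_one]
  have hMeq : (mfderiv 𝓘(ℝ, E) 𝓘(ℝ, E) φ 1 : E →L[ℝ] E) = M :=
    ContinuousLinearMap.ext hM
  have hder' : HasFDerivAt (fun z ↦ chartAt E (1 : G) (φ ((chartAt E (1 : G)).symm z))) M
      (chartAt E (1 : G) 1) := by
    rw [hw] at hder
    have hder2 : HasFDerivWithinAt (fun z ↦ chartAt E (1 : G) (φ ((chartAt E (1 : G)).symm z))) M
        (range 𝓘(ℝ, E)) (extChartAt 𝓘(ℝ, E) (1 : G) 1) := hMeq ▸ hder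
    simpa using hder2
  have hL1 : L.symm (e 1) = chartAt E (1 : G) 1 := by simp [he, identityChart_apply]
  have hcomp : HasFDerivAt (fun z ↦ e (φ (e.symm z)))
      ((L : E →L[ℝ] F) ∘L M ∘L (L.symm : F →L[ℝ] E)) (e 1) := by
    rw [← hL1] at hder'
    exact L.hasFDerivAt.comp (e 1) (hder'.comp (e 1) L.symm.hasFDerivAt)
  rwa [hstrict.hasFDerivAt.unique hcomp] at hstrict

end LieChart

/-- A contracting diagonal operator. -/
lemma diagonal_clm_det_and_norm {n : ℕ} (T : (Fin n → ℝ) →L[ℝ] (Fin n → ℝ)) (d : Fin n → ℝ)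
    (hT : ∀ i, T (Pi.single i 1) = d i • Pi.single i 1) (hd0 : ∀ i, 0 ≤ d i) (hd1 : ∀ i, d i < 1) :
    T.det = ∏ i, d i ∧ ‖T‖ < 1 := by
  have hTv : (T : (Fin n → ℝ) →ₗ[ℝ] (Fin n → ℝ)) = Matrix.toLin' (Matrix.diagonal d) := by
    refine LinearMap.pi_ext' fun i ↦ LinearMap.ext_ring ?_
    simp [hT, ← Pi.single_smul]
  have hTapp : ∀ v i, T v i = d i * v i := by
    intro v i
    have := congrArg (fun A : (Fin n → ℝ) →ₗ[ℝ] (Fin n → ℝ) ↦ A v i) hTv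
    simpa [Matrix.mulVec_diagonal] using this
  constructor
  · rw [ContinuousLinearMap.det, hTv, LinearMap.det_toLin', Matrix.det_diagonal]
  -- Choosing `κ` just below `1`, instead of the maximum of the `d i`, also covers `n = 0`.
  · have hev : ∀ᶠ κ in 𝓝[<] (1 : ℝ), 0 ≤ κ ∧ κ < 1 ∧ ∀ i, d i ≤ κ := by
      have h1 : ∀ᶠ κ in 𝓝[<] (1 : ℝ), ∀ i, d i ≤ κ := eventually_all.2 fun i ↦
        mem_of_superset (Ico_mem_nhdsLT (hd1 i)) fun κ h ↦ h.1
      filter_upwards [Ico_mem_nhdsLT (zero_lt_one (α := ℝ)), h1] with κ h h'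
      exact ⟨h.1, h.2, h'⟩
    obtain ⟨κ, hκ0, hκ1, hκ⟩ := hev.exists
    refine (T.opNorm_le_bound hκ0 fun v ↦ ?_).trans_lt hκ1
    refine (pi_norm_le_iff_of_nonneg (by positivity)).2 fun i ↦ ?_
    rw [hTapp, norm_mul, Real.norm_of_nonneg (hd0 i)]
    exact mul_le_mul (hκ i) (norm_le_pi_norm v i) (norm_nonneg _) hκ0

/-! ### Scaling of Haar measure under the dilations. -/

namespace GroupDilations

variable {E : Type*} [NormedAddCommGroup E] [NormedSpace ℝ E] [FiniteDimensional ℝ E]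
  {G : Type*} [TopologicalSpace G] [T2Space G] [SecondCountableTopology G]
  [ChartedSpace E G] [Group G] [LieGroup 𝓘(ℝ, E) ∞ G] [ConnectedSpace G]

-- In dimension zero the charts make `G` discrete, and a connected discrete group is trivial.
omit [T2Space G] [SecondCountableTopology G] [LieGroup 𝓘(ℝ, E) ∞ G] in
lemma homDim_pos [Nontrivial G] (D : GroupDilations E G) : 0 < D.homDim := by
  have hne : Nonempty (Fin (Module.finrank ℝ E)) := by
    rw [← Fin.pos_iff_nonempty]
    by_contra! h
    have hE : Subsingleton E := Module.finrank_zero_iff (R := ℝ).1 (by omega)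
    have : DiscreteTopology G := by
      rw [discreteTopology_iff_isOpen_singleton]
      intro a
      have : (chartAt E a).source = {a} := by
        refine Subset.antisymm (fun x hx ↦ ?_) (by simp)
        exact (chartAt E a).injOn hx (mem_chart_source E a) (Subsingleton.elim _ _)
      rw [← this]
      exact (chartAt E a).open_source
    obtain ⟨x, y, hxy⟩ := exists_pair_ne G
    have hx : ({x} : Set G) = univ :=
      IsClopen.eq_univ (isClopen_discrete _) (singleton_nonempty x)
    have hy : y ∈ ({x} : Set G) := by rw [hx]; trivial
    exact hxy (by simpa using hy.symm)
  exact Finset.sum_pos (fun i _ ↦ D.weight_pos i) Finset.univ_nonempty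

variable [MeasurableSpace G] [BorelSpace G]

theorem contracting_dil (D : GroupDilations E G) (μ : Measure G) [μ.IsHaarMeasure] {r : ℝ}
    (hr0 : 0 < r) (hr1 : r < 1) :
    (∀ A, MeasurableSet A → μ (D.dil r '' A) = ENNReal.ofReal (r ^ D.homDim) * μ A) ∧
    ∀ N : G → ℝ, D.IsQuasiNorm N → ∀ U ∈ 𝓝 (1 : G), ∃ c : ℝ, 0 < c ∧ {x | N x < c} ⊆ U := by
  have : IsTopologicalGroup G := topologicalGroup_of_lieGroup 𝓘(ℝ, E) ∞
  have : LocallyCompactSpace G := Manifold.locallyCompact_of_finiteDimensional 𝓘(ℝ, E)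
  have hcont : Continuous (D.dil r) := (D.contMDiff_dil r hr0).continuous
  -- The open mapping theorem for σ-compact groups supplies continuity of the inverse.
  have hopen : IsOpenMap (D.dil r) :=
    (D.dil r : G →* G).isOpenMap_of_sigmaCompact (D.dil r).surjective hcont
  let φ : G ≃ₜ* G :=
    { D.dil r with
      continuous_toFun := hcont
      continuous_invFun := ((D.dil r).toEquiv.toHomeomorphOfContinuousOpen hcont hopen).symm.continuous }
  let b : Module.Basis (Fin (Module.finrank ℝ E)) ℝ E := D.basis
  -- In eigenbasis coordinates with the sup norm the diagonal derivative has operator norm below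
  -- `1`; an arbitrary norm on `E` need not give this.
  let L : E ≃L[ℝ] (Fin (Module.finrank ℝ E) → ℝ) := b.equivFunL
  let A : E →ₗ[ℝ] E := D.lieDil r
  let M : E →L[ℝ] E := LinearMap.toContinuousLinearMap A
  set e := identityChart G L with he
  have h1 : (1 : G) ∈ e.source := one_mem_identityChart_source L
  obtain ⟨L', hL', hτ⟩ := exists_hasStrictFDerivAt_mul_identityChart (G := G) L
  set T := (L : E →L[ℝ] (Fin (Module.finrank ℝ E) → ℝ)) ∘L M ∘L
      (L.symm : (Fin (Module.finrank ℝ E) → ℝ) →L[ℝ] E) with hT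
  have hder : HasStrictFDerivAt (fun z ↦ e (φ (e.symm z))) T (e 1) :=
    hasStrictFDerivAt_identityChart L (D.dil r : G →* G) (D.contMDiff_dil r hr0) M
      (fun X ↦ D.mfderiv_dil r hr0 X)
  have hMb : ∀ i, M (b i) = r ^ D.weight i • b i := fun i ↦ D.lieDil_basis r hr0 i
  have hTd : ∀ i, T (Pi.single i 1) = r ^ D.weight i • Pi.single i 1 := by
    intro i
    have hLb : L (b i) = Pi.single i 1 := by
      simp [L, Module.Basis.equivFunL, Finsupp.single_eq_pi_single]
    have : L.symm (Pi.single i 1) = b i := by rw [← hLb, L.symm_apply_apply]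
    simp only [hT, ContinuousLinearMap.comp_apply, ContinuousLinearEquiv.coe_coe, this, hMb,
      map_smul, hLb]
  obtain ⟨hdet, hnorm⟩ := diagonal_clm_det_and_norm T _ hTd (fun i ↦ by positivity)
    (fun i ↦ Real.rpow_lt_one hr0.le hr1 (D.weight_pos i))
  have hprod : |T.det| = r ^ D.homDim := by
    rw [hdet, homDim, ← Real.rpow_sum_of_pos hr0, abs_of_pos (by positivity)]
  refine ⟨fun A hA ↦ ?_, fun N hN U hU ↦ ?_⟩
  · rw [← hprod]
    exact haar_image_contracting_automorphism μ e h1 hL' hτ φ hnorm hder hA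
  · have hsmall := fun (U : Set G) (hU : U ∈ 𝓝 (1 : G)) ↦
      exists_contracting_nhds e h1 φ hnorm hder one_pos hU
    obtain ⟨V, hVo, h1V, -, -, -, hlim, -⟩ := hsmall univ univ_mem
    refine exists_sublevel_subset φ (tendsto_iterate_of_nhds φ (hVo.mem_nhds h1V) hlim)
      (fun U hU ↦ ?_) hN.continuous hN.nonneg (fun x ↦ (hN.eq_zero_iff x).1) hr1.le
      (fun x ↦ hN.dil r hr0 x) hU
    obtain ⟨V, h1, h2, h3, -, h4, -⟩ := hsmall U hU
    exact ⟨V, h1, h2, h3, h4⟩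

lemma IsQuasiNorm.image_ball {E : Type*} [NormedAddCommGroup E] [NormedSpace ℝ E]
    {G : Type*} [TopologicalSpace G] [ChartedSpace E G] [Group G] {D : GroupDilations E G}
    {N : G → ℝ} (hN : D.IsQuasiNorm N) {r : ℝ} (hr : 0 < r) (R : ℝ) :
    D.dil r '' {x | N x < R} = {x | N x < r * R} := by
  ext x
  constructor
  · rintro ⟨y, hy, rfl⟩
    rw [mem_ofPred_eq, hN.dil r hr]
    exact mul_lt_mul_of_pos_left hy hr
  · intro hx
    obtain ⟨y, rfl⟩ := (D.dil r).surjective x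
    rw [mem_ofPred_eq, hN.dil r hr] at hx
    exact ⟨y, lt_of_mul_lt_mul_left hx hr.le, rfl⟩

theorem IsQuasiNorm.measure_ball {D : GroupDilations E G} {N : G → ℝ} (hN : D.IsQuasiNorm N)
    (μ : Measure G) [μ.IsHaarMeasure] :
    μ {x | N x < 1} ≠ 0 ∧ μ {x | N x < 1} ≠ ⊤ ∧
      ∀ r, 0 < r → μ {x | N x < r} = ENNReal.ofReal (r ^ D.homDim) * μ {x | N x < 1} := by
  have : LocallyCompactSpace G := Manifold.locallyCompact_of_finiteDimensional 𝓘(ℝ, E)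
  have hopen : ∀ r, IsOpen {x | N x < r} := fun r ↦ isOpen_lt hN.continuous continuous_const
  have h1 : N 1 = 0 := (hN.eq_zero_iff 1).2 rfl
  have hsc : ∀ r, 0 < r → r < 1 → ∀ R, μ {x | N x < r * R}
      = ENNReal.ofReal (r ^ D.homDim) * μ {x | N x < R} := by
    intro r hr0 hr1 R
    rw [← hN.image_ball hr0, (D.contracting_dil μ hr0 hr1).1 _ (hopen R).measurableSet]
  have hall : ∀ r, 0 < r → μ {x | N x < r} = ENNReal.ofReal (r ^ D.homDim) * μ {x | N x < 1} := by
    intro r hr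
    rcases lt_trichotomy r 1 with h | rfl | h
    · simpa using hsc r hr h 1
    · simp
    -- Radii above `1` are handled by shrinking back to the unit ball.
    · have := hsc r⁻¹ (by positivity) (inv_lt_one_of_one_lt₀ h) r
      rw [inv_mul_cancel₀ hr.ne'] at this
      rw [this, ← mul_assoc, ← ENNReal.ofReal_mul (by positivity),
        ← Real.mul_rpow hr.le (by positivity), mul_inv_cancel₀ hr.ne']
      simp
  refine ⟨((hopen 1).measure_pos μ ⟨1, by simp [h1]⟩).ne', ?_, hall⟩
  -- Some small ball lies in a compact set and has finite measure; scaling transfers this to the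
  -- unit ball.
  obtain ⟨K, hKc, hK⟩ := exists_compact_mem_nhds (1 : G)
  obtain ⟨c, hc, hcK⟩ := (D.contracting_dil μ one_half_pos one_half_lt_one).2 N hN K hK
  have hlt := (measure_mono hcK).trans_lt (hKc.measure_lt_top (μ := μ))
  rw [hall c hc] at hlt
  intro htop
  rw [htop, ENNReal.mul_top (by simpa using Real.rpow_pos_of_pos hc _)] at hlt
  exact lt_irrefl _ hlt

end GroupDilations

/-! ### Radial integration and Minkowski's inequality. -/

section Radial

variable {X : Type*} [MeasurableSpace X]

/-- The function `N` is distributed under `μ` like `|x|` under the Haar measure of a homogeneous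
group of homogeneous dimension `Q` whose unit sphere has area `σ`. -/
structure IsRadialGauge (μ : Measure X) (N : X → ℝ) (Q σ : ℝ) : Prop where
  measurable : Measurable N
  nonneg : ∀ x, 0 ≤ N x
  dim_pos : 0 < Q
  area_pos : 0 < σ
  measure_ball : ∀ r, 0 < r → μ {x | N x < r} = ENNReal.ofReal (σ / Q * r ^ Q)

namespace IsRadialGauge

variable {μ : Measure X} {N : X → ℝ} {Q σ : ℝ}

/-- Half-open intervals determine the measure, and on them both sides are differences of ball
measures, since `σ r ^ (Q - 1)` is the derivative of `σ / Q * r ^ Q`. -/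
lemma map_eq (h : IsRadialGauge μ N Q σ) :
    μ.map N = (volume.restrict (Ioi 0)).withDensity (fun r ↦ ENNReal.ofReal (σ * r ^ (Q - 1))) := by
  have hQ := h.dim_pos
  have hσ := h.area_pos
  have hball : ∀ r, 0 ≤ r → μ {x | N x < r} = ENNReal.ofReal (σ / Q * r ^ Q) := by
    intro r hr
    rcases hr.eq_or_lt with rfl | hr
    · have : {x | N x < 0} = ∅ := by
        ext x; simpa using h.nonneg x
      simp [this, Real.zero_rpow hQ.ne']
    · exact h.measure_ball r hr
  have hIco : ∀ a b, μ.map N (Ico a b) = μ {x | a ≤ N x ∧ N x < b} := fun a b ↦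
    Measure.map_apply h.measurable measurableSet_Ico
  refine Measure.ext_of_Ico' _ _ (fun a b hab ↦ ?_) fun a b hab ↦ ?_
  · rw [hIco]
    refine ((measure_mono (fun x hx ↦ ?_ : _ ⊆ {x | N x < max b 1})).trans_lt ?_).ne
    · exact hx.2.trans_le (le_max_left _ _)
    · rw [hball _ (by positivity)]; exact ENNReal.ofReal_lt_top
  rw [hIco, withDensity_apply _ measurableSet_Ico, Measure.restrict_restrict measurableSet_Ico]
  rcases le_or_gt b 0 with hb | hb
  · have h1 : {x | a ≤ N x ∧ N x < b} = ∅ := by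
      ext x
      simp only [mem_ofPred_eq, mem_empty_iff_false, iff_false, not_and, not_lt]
      exact fun _ ↦ hb.trans (h.nonneg x)
    have h2 : Ico a b ∩ Ioi 0 = ∅ := by
      ext x
      simp only [mem_inter_iff, mem_Ico, mem_Ioi, mem_empty_iff_false, iff_false, not_and, not_lt]
      exact fun hx ↦ (hx.2.trans_le hb).le
    simp [h1, h2]
  set c := max a 0 with hc
  have hc0 : 0 ≤ c := le_max_right _ _
  have hcb : c < b := max_lt hab hb
  have hset : {x | a ≤ N x ∧ N x < b} = {x | N x < b} \ {x | N x < c} := by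
    ext x
    simp only [mem_ofPred_eq, Set.mem_sdiff, not_lt, hc, max_le_iff]
    exact ⟨fun hx ↦ ⟨hx.2, hx.1, h.nonneg x⟩, fun hx ↦ ⟨hx.2.1, hx.1⟩⟩
  have hsub : {x | N x < c} ⊆ {x | N x < b} := fun x hx ↦ lt_trans hx hcb
  have hmc : MeasurableSet {x | N x < c} := h.measurable measurableSet_Iio
  have hae : (Ico a b ∩ Ioi 0 : Set ℝ) =ᵐ[volume] Ioc c b := by
    have h1 : (Ioo c b : Set ℝ) =ᵐ[volume] Ioc c b := Ioo_ae_eq_Ioc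
    refine EventuallyEq.trans ?_ h1
    have h2 : (Ico c b : Set ℝ) =ᵐ[volume] Ioo c b := Ioo_ae_eq_Ico.symm
    have h3 : (Ico a b ∩ Ioi 0 : Set ℝ) =ᵐ[volume] (Ico a b ∩ Ici 0 : Set ℝ) :=
      EventuallyEq.rfl.inter Ioi_ae_eq_Ici
    refine h3.trans (EventuallyEq.trans ?_ h2)
    rw [Ico_inter_Ici]
    exact EventuallyEq.rfl
  rw [setLIntegral_congr hae, hset, measure_sdiff hsub hmc.nullMeasurableSet
    (by rw [hball c hc0]; exact ENNReal.ofReal_ne_top), hball c hc0, hball b hb.le,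
    ← ENNReal.ofReal_sub _ (by positivity)]
  have hint : IntervalIntegrable (fun r : ℝ ↦ σ * r ^ (Q - 1)) volume c b :=
    (intervalIntegral.intervalIntegrable_rpow' (by linarith)).const_mul σ
  rw [← ofReal_integral_eq_lintegral_ofReal
    ((intervalIntegrable_iff_integrableOn_Ioc_of_le hcb.le).1 hint)]
  · rw [← intervalIntegral.integral_of_le hcb.le, intervalIntegral.integral_const_mul,
      integral_rpow (Or.inl (by linarith))]
    congr 1
    rw [sub_add_cancel]
    ring
  · filter_upwards [ae_restrict_mem measurableSet_Ioc] with r hr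
    have : 0 < r := hc0.trans_lt hr.1
    change 0 ≤ σ * r ^ (Q - 1)
    positivity

/-- Integration of radial functions. -/
lemma lintegral_comp (h : IsRadialGauge μ N Q σ) {f : ℝ → ℝ≥0∞} (hf : Measurable f) :
    ∫⁻ x, f (N x) ∂μ = ∫⁻ r in Ioi 0, ENNReal.ofReal (σ * r ^ (Q - 1)) * f r := by
  rw [← lintegral_map hf h.measurable, h.map_eq,
    lintegral_withDensity_eq_lintegral_mul _ (by fun_prop) hf]
  rfl

lemma setLIntegral_rpow (h : IsRadialGauge μ N Q σ) {s : Set ℝ} (hs : MeasurableSet s) (b : ℝ) :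
    ∫⁻ x in N ⁻¹' s, ENNReal.ofReal (N x ^ b) ∂μ
      = ∫⁻ r in s ∩ Ioi 0, ENNReal.ofReal (σ * r ^ (b + Q - 1)) := by
  rw [← lintegral_indicator (h.measurable hs)]
  have h1 : ∀ x, (N ⁻¹' s).indicator (fun x ↦ ENNReal.ofReal (N x ^ b)) x
      = s.indicator (fun r ↦ ENNReal.ofReal (r ^ b)) (N x) := fun x ↦ rfl
  simp_rw [h1]
  rw [h.lintegral_comp ((by fun_prop : Measurable fun r : ℝ ↦ ENNReal.ofReal (r ^ b)).indicator hs),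
    ← Measure.restrict_restrict hs, ← lintegral_indicator hs]
  refine setLIntegral_congr_fun measurableSet_Ioi fun r hr ↦ ?_
  have hr : 0 < r := hr
  by_cases hrs : r ∈ s
  · simp only [indicator_of_mem hrs]
    have := h.area_pos
    rw [← ENNReal.ofReal_mul (by positivity), mul_assoc, ← Real.rpow_add hr]
    ring_nf
  · simp [hrs]

lemma ae_pos (h : IsRadialGauge μ N Q σ) : ∀ᵐ x ∂μ, 0 < N x := by
  have : (∫⁻ x in N ⁻¹' (Iic 0), ENNReal.ofReal (N x ^ (0 : ℝ)) ∂μ) = 0 := by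
    rw [h.setLIntegral_rpow measurableSet_Iic, Iic_inter_Ioi]
    simp
  simp only [Real.rpow_zero, ENNReal.ofReal_one, setLIntegral_one] at this
  rw [ae_iff]
  convert this using 2
  ext x
  simp

lemma lintegral_ball_rpow (h : IsRadialGauge μ N Q σ) {b R : ℝ} (hb : 0 < b + Q) (hR : 0 < R) :
    ∫⁻ x in {x | N x < R}, ENNReal.ofReal (N x ^ b) ∂μ
      = ENNReal.ofReal (σ / (b + Q) * R ^ (b + Q)) := by
  have hσ := h.area_pos
  have h1 := h.setLIntegral_rpow (measurableSet_Iio (a := R)) b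
  have hae : (Iio R ∩ Ioi 0 : Set ℝ) =ᵐ[volume] Ioc 0 R := by
    rw [inter_comm, Ioi_inter_Iio]
    exact Ioo_ae_eq_Ioc
  have hint : IntervalIntegrable (fun r : ℝ ↦ σ * r ^ (b + Q - 1)) volume 0 R :=
    (intervalIntegral.intervalIntegrable_rpow' (by linarith)).const_mul σ
  rw [setLIntegral_congr hae, ← ofReal_integral_eq_lintegral_ofReal
    ((intervalIntegrable_iff_integrableOn_Ioc_of_le hR.le).1 hint),
    ← intervalIntegral.integral_of_le hR.le, intervalIntegral.integral_const_mul,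
    integral_rpow (Or.inl (by linarith)), sub_add_cancel, Real.zero_rpow hb.ne'] at h1
  · refine h1.trans ?_
    congr 1
    ring
  · filter_upwards [ae_restrict_mem measurableSet_Ioc] with r hr
    have : 0 < r := hr.1
    change 0 ≤ σ * r ^ (b + Q - 1)
    positivity

lemma lintegral_compl_ball_rpow (h : IsRadialGauge μ N Q σ) {a R : ℝ} (ha : a + Q < 0)
    (hR : 0 < R) :
    ∫⁻ x in {x | R ≤ N x}, ENNReal.ofReal (N x ^ a) ∂μ
      = ENNReal.ofReal (σ / |a + Q| * R ^ (a + Q)) := by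
  have hσ := h.area_pos
  have h1 := h.setLIntegral_rpow (measurableSet_Ici (a := R)) a
  have hae : (Ici R ∩ Ioi 0 : Set ℝ) =ᵐ[volume] Ioi R := by
    have : (Ici R ∩ Ioi 0 : Set ℝ) = Ici R := inter_eq_left.2 fun x hx ↦ hR.trans_le hx
    rw [this]
    exact Ioi_ae_eq_Ici.symm
  rw [setLIntegral_congr hae, ← ofReal_integral_eq_lintegral_ofReal
    ((integrableOn_Ioi_rpow_of_lt (by linarith) hR).const_mul σ),
    integral_const_mul, integral_Ioi_rpow_of_lt (by linarith) hR, sub_add_cancel] at h1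
  · refine h1.trans ?_
    congr 1
    rw [abs_of_neg ha]
    have := ha.ne
    field_simp
  · filter_upwards [ae_restrict_mem measurableSet_Ioi] with r hr
    have : 0 < r := hR.trans hr
    change 0 ≤ σ * r ^ (a + Q - 1)
    positivity

/-- A power is integrable at infinity only if its exponent is below `-1`; this and the counterpart
at the origin yield the sign conditions. -/
lemma lt_zero_of_lintegral_compl_ball_rpow_ne_top (h : IsRadialGauge μ N Q σ) {a R : ℝ}
    (hR : 0 < R) (hfin : ∫⁻ x in {x | R ≤ N x}, ENNReal.ofReal (N x ^ a) ∂μ ≠ ⊤) :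
    a + Q < 0 := by
  have hσ := h.area_pos
  have h1 := h.setLIntegral_rpow (measurableSet_Ici (a := R)) a
  have hsub : Ioi R ⊆ Ici R ∩ Ioi 0 := fun x (hx : R < x) ↦ ⟨hx.le, hR.trans hx⟩
  have hlt : ∫⁻ r in Ioi R, ENNReal.ofReal (σ * r ^ (a + Q - 1)) < ⊤ := by
    refine (lintegral_mono_set hsub).trans_lt ?_
    rw [← h1]
    exact hfin.lt_top
  have hint : IntegrableOn (fun r : ℝ ↦ σ * r ^ (a + Q - 1)) (Ioi R) := by
    refine ⟨by fun_prop, ?_⟩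
    rw [hasFiniteIntegral_iff_ofReal]
    · exact hlt
    · filter_upwards [ae_restrict_mem measurableSet_Ioi] with r hr
      have : 0 < r := hR.trans hr
      change 0 ≤ σ * r ^ (a + Q - 1)
      positivity
  have hint' : IntegrableOn (fun r : ℝ ↦ r ^ (a + Q - 1)) (Ioi R) := by
    have := hint.const_mul σ⁻¹
    simpa [IntegrableOn, ← mul_assoc, inv_mul_cancel₀ hσ.ne'] using this
  have := (integrableOn_Ioi_rpow_iff hR).1 hint'
  linarith

lemma pos_of_lintegral_ball_rpow_ne_top (h : IsRadialGauge μ N Q σ) {b R : ℝ}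
    (hR : 0 < R) (hfin : ∫⁻ x in {x | 0 < N x ∧ N x < R}, ENNReal.ofReal (N x ^ b) ∂μ ≠ ⊤) :
    0 < b + Q := by
  have hσ := h.area_pos
  have h1 := h.setLIntegral_rpow (measurableSet_Ioo (a := 0) (b := R)) b
  have hsub : Ioo 0 R ∩ Ioi 0 = Ioo 0 R := inter_eq_left.2 fun x hx ↦ hx.1
  rw [hsub] at h1
  have hint : IntegrableOn (fun r : ℝ ↦ σ * r ^ (b + Q - 1)) (Ioo 0 R) := by
    refine ⟨by fun_prop, ?_⟩
    rw [hasFiniteIntegral_iff_ofReal]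
    · rw [← h1]; exact hfin.lt_top
    · filter_upwards [ae_restrict_mem measurableSet_Ioo] with r hr
      have : 0 < r := hr.1
      change 0 ≤ σ * r ^ (b + Q - 1)
      positivity
  have hint' : IntegrableOn (fun r : ℝ ↦ r ^ (b + Q - 1)) (Ioo 0 R) := by
    have := hint.const_mul σ⁻¹
    simpa [IntegrableOn, ← mul_assoc, inv_mul_cancel₀ hσ.ne'] using this
  have := (intervalIntegral.integrableOn_Ioo_rpow_iff hR).1 hint'
  linarith

end IsRadialGauge

/-- **Minkowski's integral inequality**. -/
theorem lintegral_lintegral_rpow_le {Y : Type*} [MeasurableSpace Y] (μ : Measure X) [SigmaFinite μ]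
    (ν : Measure Y) [SFinite ν] {K : X → Y → ℝ≥0∞} (hK : Measurable (Function.uncurry K))
    {s : ℝ} (hs : 1 ≤ s) :
    ∫⁻ x, (∫⁻ y, K x y ∂ν) ^ s ∂μ ≤ (∫⁻ y, (∫⁻ x, K x y ^ s ∂μ) ^ (1 / s) ∂ν) ^ s := by
  rcases hs.eq_or_lt with rfl | hs1
  · simp only [ENNReal.rpow_one, one_div, inv_one]
    exact (lintegral_lintegral_swap hK.aemeasurable).le
  have hs0 : 0 < s := by linarith
  set J := ∫⁻ y, (∫⁻ x, K x y ^ s ∂μ) ^ (1 / s) ∂ν with hJ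
  set g : X → ℝ≥0∞ := fun x ↦ ∫⁻ y, K x y ∂ν with hg
  have hgm : Measurable g := hK.lintegral_prod_right
  -- Truncating in height and support makes the integral `I` below finite, so that a power of it can
  -- be cancelled.
  set h : ℕ → X → ℝ≥0∞ := fun n ↦ (spanningSets μ n).indicator fun x ↦ min (g x) n with hh
  have hhm : ∀ n, Measurable (h n) := fun n ↦
    (hgm.min measurable_const).indicator (measurableSet_spanningSets μ n)
  have hhg : ∀ n x, h n x ≤ g x := fun n x ↦
    (indicator_le_self' (fun _ _ ↦ zero_le) x).trans (min_le_left _ _)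
  have hbound : ∀ n, ∫⁻ x, h n x ^ s ∂μ ≤ J ^ s := by
    intro n
    set I := ∫⁻ x, h n x ^ s ∂μ with hI
    have hIfin : I ≠ ⊤ := by
      refine ne_of_lt (lt_of_le_of_lt (lintegral_mono fun x ↦
        (?_ : h n x ^ s ≤ (spanningSets μ n).indicator (fun _ ↦ (n : ℝ≥0∞) ^ s) x)) ?_)
      · by_cases hx : x ∈ spanningSets μ n
        · simp only [hh, indicator_of_mem hx]
          gcongr
          exact min_le_right _ _
        · simp [hh, indicator_of_notMem hx, hs0]
      · rw [lintegral_indicator_const (measurableSet_spanningSets μ n)]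
        exact ENNReal.mul_lt_top (ENNReal.rpow_lt_top_of_nonneg hs0.le (by simp))
          (measure_spanningSets_lt_top μ n)
    rcases eq_or_ne I 0 with hI0 | hI0
    · simp [hI0]
    have hconj : s.HolderConjugate (s / (s - 1)) := Real.HolderConjugate.conjExponent hs1
    have hq : s / (s - 1) * (s - 1) = s := by
      have : s - 1 ≠ 0 := by linarith
      field_simp
    -- Split off one factor `h ≤ g = ∫ K`, swap the integrals, and apply Hölder's inequality in `x`
    -- for each `y`.
    have hkey : I ≤ I ^ (1 / (s / (s - 1))) * J := by
      calc I ≤ ∫⁻ x, ∫⁻ y, h n x ^ (s - 1) * K x y ∂ν ∂μ := by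
            refine lintegral_mono fun x ↦ ?_
            rw [lintegral_const_mul _ hK.of_uncurry_left]
            calc h n x ^ s = h n x ^ ((s - 1) + 1) := by rw [sub_add_cancel]
              _ = h n x ^ (s - 1) * h n x := by
                  rw [ENNReal.rpow_add_of_nonneg _ _ (by linarith) zero_le_one, ENNReal.rpow_one]
              _ ≤ _ := by gcongr; exact hhg n x
        _ = ∫⁻ y, ∫⁻ x, h n x ^ (s - 1) * K x y ∂μ ∂ν := by
            refine lintegral_lintegral_swap ?_
            exact ((((hhm n).comp measurable_fst).pow_const _).mul hK).aemeasurable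
        _ ≤ ∫⁻ y, I ^ (1 / (s / (s - 1))) * (∫⁻ x, K x y ^ s ∂μ) ^ (1 / s) ∂ν := by
            refine lintegral_mono fun y ↦ ?_
            have := ENNReal.lintegral_mul_le_Lp_mul_Lq μ hconj.symm
              ((hhm n).pow_const (s - 1)).aemeasurable (hK.of_uncurry_right (y := y)).aemeasurable
            refine this.trans (le_of_eq ?_)
            simp_rw [← ENNReal.rpow_mul, mul_comm (s - 1), hq]
            rfl
        _ = _ := by
            rw [lintegral_const_mul]
            exact (hK.pow_const s).lintegral_prod_left.pow_const _
    have hsplit : I = I ^ (1 / (s / (s - 1))) * I ^ (1 / s) := by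
      rw [← ENNReal.rpow_add _ _ hI0 hIfin]
      have : 1 / (s / (s - 1)) + 1 / s = 1 := by field_simp; ring
      rw [this, ENNReal.rpow_one]
    have hne0 : I ^ (1 / (s / (s - 1))) ≠ 0 := by
      simp [ENNReal.rpow_eq_zero_iff, hI0, hIfin]
    have hnet : I ^ (1 / (s / (s - 1))) ≠ ⊤ := by
      simp [ENNReal.rpow_eq_top_iff, hI0, hIfin]
    have hle : I ^ (1 / s) ≤ J := by
      rw [← ENNReal.mul_le_mul_iff_right hne0 hnet, ← hsplit]
      exact hkey
    calc I = (I ^ (1 / s)) ^ s := by rw [← ENNReal.rpow_mul, one_div_mul_cancel hs0.ne',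
          ENNReal.rpow_one]
      _ ≤ J ^ s := by gcongr
  have hlim : ∀ x, Tendsto (fun n ↦ h n x ^ s) atTop (𝓝 (g x ^ s)) := by
    intro x
    refine (ENNReal.continuous_rpow_const.tendsto (g x)).comp ?_
    have hmin : Tendsto (fun n : ℕ ↦ min (g x) n) atTop (𝓝 (g x)) := by
      have := (tendsto_const_nhds (x := g x)).min ENNReal.tendsto_nat_nhds_top
      simpa using this
    refine hmin.congr' ?_
    obtain ⟨n₀, hn₀⟩ := mem_iUnion.1 ((iUnion_spanningSets μ).symm ▸ mem_univ x :
      x ∈ ⋃ i, spanningSets μ i)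
    filter_upwards [eventually_ge_atTop n₀] with n hn
    simp [hh, indicator_of_mem (monotone_spanningSets μ hn hn₀)]
  -- Fatou's lemma removes the truncation.
  calc ∫⁻ x, g x ^ s ∂μ = ∫⁻ x, liminf (fun n ↦ h n x ^ s) atTop ∂μ :=
        lintegral_congr fun x ↦ (hlim x).liminf_eq.symm
    _ ≤ liminf (fun n ↦ ∫⁻ x, h n x ^ s ∂μ) atTop :=
        lintegral_liminf_le fun n ↦ (hhm n).pow_const s
    _ ≤ J ^ s := liminf_le_of_le (by isBoundedDefault) fun b hb ↦ by
        obtain ⟨n, hn⟩ := hb.exists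
        exact hn.trans (hbound n)

end Radial

/-! ### Power weights and sufficiency of the conditions. -/

section PowerWeight

variable {X : Type*} {N : X → ℝ} {x : X}

/-- The weight `|x| ^ c` as an extended nonnegative real number. -/
noncomputable def powerWeight (N : X → ℝ) (c : ℝ) (x : X) : ℝ≥0∞ := ENNReal.ofReal (N x ^ c)

lemma powerWeight_mul (hx : 0 < N x) (c d : ℝ) :
    powerWeight N c x * powerWeight N d x = powerWeight N (c + d) x := by
  rw [powerWeight, powerWeight, powerWeight, ← ENNReal.ofReal_mul (by positivity),
    Real.rpow_add hx]

lemma powerWeight_rpow (hx : 0 < N x) (c e : ℝ) :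
    powerWeight N c x ^ e = powerWeight N (c * e) x := by
  rw [powerWeight, powerWeight, ENNReal.ofReal_rpow_of_pos (by positivity), Real.rpow_mul hx.le]

lemma powerWeight_zero : powerWeight N 0 x = 1 := by simp [powerWeight]

lemma measurable_powerWeight [MeasurableSpace X] (hN : Measurable N) (c : ℝ) :
    Measurable (powerWeight N c) :=
  (hN.pow_const c).ennreal_ofReal

end PowerWeight

namespace IsRadialGauge

variable {X : Type*} [MeasurableSpace X] {μ : Measure X} {N : X → ℝ} {Q σ : ℝ}

/-- Hölder's inequality on a ball with the power weight that is optimal for the Hardy inequality. -/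
lemma lintegral_ball_le (h : IsRadialGauge μ N Q σ) {p p' β : ℝ} (hpp' : p.HolderConjugate p')
    (hB : 0 < β * (1 - p') + Q) {F : X → ℝ≥0∞} (hF : Measurable F) {x : X} (hx : 0 < N x) :
    ∫⁻ y in {y | N y < N x}, F y ∂μ ≤
      (∫⁻ y in {y | N y < N x}, F y ^ p * powerWeight N (β + (β * (1 - p') + Q) / p') y ∂μ) ^ (1 / p)
        * (ENNReal.ofReal (σ * p' / (β * (1 - p') + Q))
          * powerWeight N ((β * (1 - p') + Q) / p') x) ^ (1 / p') := by
  have hp := hpp'.pos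
  have hp' := hpp'.symm.pos
  have hσ := h.area_pos
  set B := β * (1 - p') + Q with hBdef
  have hinv := hpp'.inv_add_inv_eq_one
  -- Muckenhoupt's weight: `|y| ^ (β / p)` times the power `1 / (p p')` of `∫ |z| ^ (β (1 - p')) dz`
  -- over `B(0, |y|)`, up to a constant.
  set t : ℝ := β / p + B / (p * p') with ht
  have htp : t * p = β + B / p' := by rw [ht]; field_simp
  have htp' : -t * p' + Q = B / p' := by
    have e1 : p'⁻¹ = 1 - p⁻¹ := by linarith
    have e2 : p' / p = p' - 1 := by
      have : p' * (p⁻¹ + p'⁻¹) = p' := by rw [hinv, mul_one]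
      rw [mul_add, mul_inv_cancel₀ hp'.ne'] at this
      rw [div_eq_mul_inv]; linarith
    have e3 : t * p' = β * (p' / p) + B * p⁻¹ := by rw [ht]; field_simp
    rw [neg_mul, e3, e2, div_eq_mul_inv, e1, hBdef]
    ring
  have hm : ∀ c, Measurable (powerWeight N c) := measurable_powerWeight h.measurable
  have hpos : ∀ᵐ y ∂(μ.restrict {y | N y < N x}), 0 < N y := ae_restrict_of_ae h.ae_pos
  calc ∫⁻ y in {y | N y < N x}, F y ∂μ
      = ∫⁻ y in {y | N y < N x}, (F y * powerWeight N t y) * powerWeight N (-t) y ∂μ := by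
        refine lintegral_congr_ae ?_
        filter_upwards [hpos] with y hy
        rw [mul_assoc, powerWeight_mul hy, add_neg_cancel, powerWeight_zero, mul_one]
    _ ≤ (∫⁻ y in {y | N y < N x}, (F y * powerWeight N t y) ^ p ∂μ) ^ (1 / p)
        * (∫⁻ y in {y | N y < N x}, powerWeight N (-t) y ^ p' ∂μ) ^ (1 / p') :=
        ENNReal.lintegral_mul_le_Lp_mul_Lq _ hpp' (hF.mul (hm t)).aemeasurable (hm _).aemeasurable
    _ = _ := by
        congr 2
        · refine lintegral_congr_ae ?_
          filter_upwards [hpos] with y hy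
          rw [ENNReal.mul_rpow_of_nonneg _ _ hp.le, powerWeight_rpow hy, htp]
        · have h1 : ∫⁻ y in {y | N y < N x}, powerWeight N (-t) y ^ p' ∂μ
              = ∫⁻ y in {y | N y < N x}, ENNReal.ofReal (N y ^ (-t * p')) ∂μ := by
            refine lintegral_congr_ae ?_
            filter_upwards [hpos] with y hy
            rw [powerWeight_rpow hy]; rfl
          rw [h1, h.lintegral_ball_rpow (by rw [htp']; positivity) hx, htp', powerWeight,
            ← ENNReal.ofReal_mul (by positivity)]
          congr 2
          field_simp

/-- The weighted Hölder bound turns the left side into a mixed norm of the kernel `K`. Minkowski's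
inequality then reduces it to a tail integral of a power for each fixed `y`. -/
theorem hardyInequality [SigmaFinite μ] (h : IsRadialGauge μ N Q σ) {p p' q α β : ℝ}
    (hpp' : p.HolderConjugate p') (hpq : p ≤ q) (hA : α + Q < 0)
    (hB : 0 < β * (1 - p') + Q) (hbal : (α + Q) / q + (β * (1 - p') + Q) / p' = 0) :
    HardyInequality μ N p q α β (p' ^ (1 / p') * p ^ (1 / q) *
      (σ ^ (1 / q + 1 / p') / (|α + Q| ^ (1 / q) * (β * (1 - p') + Q) ^ (1 / p')))) := by
  intro f hf
  have hp := hpp'.pos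
  have hp' := hpp'.symm.pos
  have hq : 0 < q := hp.trans_le hpq
  have hσ := h.area_pos
  have hA' : 0 < |α + Q| := abs_pos.2 hA.ne
  have hAeq : α + Q = -|α + Q| := by rw [abs_of_neg hA, neg_neg]
  have hinv := hpp'.inv_add_inv_eq_one
  set B := β * (1 - p') + Q with hBdef
  set A := |α + Q| with hAdef
  set F : X → ℝ≥0∞ := fun y ↦ ‖f y‖ₑ with hFdef
  have hF : Measurable F := hf.enorm
  have hm : ∀ c, Measurable (powerWeight N c) := measurable_powerWeight h.measurable
  set g : X → ℝ≥0∞ := fun y ↦ F y ^ p * powerWeight N (β + B / p') y with hgdef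
  have hg : Measurable g := (hF.pow_const p).mul (hm _)
  set s : ℝ := q / p with hs
  have hs0 : 0 < s := by positivity
  have hs1 : 1 ≤ s := (one_le_div hp).2 hpq
  -- `γ` is the total power of `|x|` after Hölder's inequality. The balance condition turns `γ + Q`
  -- into `-(A / p)`, so the tail integral converges.
  set γ : ℝ := B / p' * (1 / p') * q + α with hγ
  have hBA : B / p' = A / q := by
    rw [hAeq, neg_div] at hbal; linarith
  have hγQ : γ + Q = -(A / p) := by
    have e1 : p'⁻¹ = 1 - p⁻¹ := by linarith
    have e2 : A / q * q = A := by field_simp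
    rw [hγ, hBA, mul_right_comm, e2, one_div, e1, div_eq_mul_inv, add_assoc, hAeq]
    ring
  -- `k₁` comes from the Hölder factor over the ball, `k₂` from the tail integral; the final
  -- constant is `k₁ ^ (1 / p') * k₂ ^ (1 / q)`.
  set k₁ : ℝ := σ * p' / B with hk₁
  set k₂ : ℝ := σ * p / A with hk₂
  have hk₁0 : 0 < k₁ := by positivity
  have hk₂0 : 0 < k₂ := by positivity
  set Φ := ∫⁻ x, F x ^ p * powerWeight N β x ∂μ with hΦ
  set K : X → X → ℝ≥0∞ := fun x y ↦
    {y | N y < N x}.indicator g y * powerWeight N (γ / s) x with hK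
  have hKm : Measurable (Function.uncurry K) := by
    have hset : MeasurableSet {z : X × X | N z.2 < N z.1} :=
      measurableSet_lt (h.measurable.comp measurable_snd) (h.measurable.comp measurable_fst)
    exact ((hg.comp measurable_snd).indicator hset).mul ((hm _).comp measurable_fst)
  have hstep : ∀ᵐ x ∂μ, (∫⁻ y in {y | N y < N x}, F y ∂μ) ^ q * powerWeight N α x
      ≤ ENNReal.ofReal k₁ ^ (1 / p' * q) * (∫⁻ y, K x y ∂μ) ^ s := by
    filter_upwards [h.ae_pos] with x hx
    have hball : MeasurableSet {y | N y < N x} := h.measurable measurableSet_Iio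
    have hKint : ∫⁻ y, K x y ∂μ
        = (∫⁻ y in {y | N y < N x}, g y ∂μ) * powerWeight N (γ / s) x := by
      rw [lintegral_mul_const _ (hg.indicator hball), lintegral_indicator hball]
    calc (∫⁻ y in {y | N y < N x}, F y ∂μ) ^ q * powerWeight N α x
        ≤ ((∫⁻ y in {y | N y < N x}, g y ∂μ) ^ (1 / p)
          * (ENNReal.ofReal k₁ * powerWeight N (B / p') x) ^ (1 / p')) ^ q
            * powerWeight N α x := by
          gcongr
          exact h.lintegral_ball_le hpp' hB hF hx
      _ = _ := by
          rw [hKint, ENNReal.mul_rpow_of_nonneg _ _ hq.le, ← ENNReal.rpow_mul, ← ENNReal.rpow_mul,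
            ENNReal.mul_rpow_of_nonneg _ _ (by positivity), ENNReal.mul_rpow_of_nonneg _ _ hs0.le,
            powerWeight_rpow hx, powerWeight_rpow hx, div_mul_cancel₀ _ hs0.ne', hγ,
            ← powerWeight_mul hx, hs]
          have e1 : 1 / p * q = q / p := by ring
          have e2 : B / p' * (1 / p' * q) = B / p' * (1 / p') * q := by ring
          rw [e1, e2]
          ring
  have hcol : ∀ᵐ y ∂μ, (∫⁻ x, K x y ^ s ∂μ) ^ (1 / s)
      ≤ ENNReal.ofReal k₂ ^ (1 / s) * (F y ^ p * powerWeight N β y) := by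
    filter_upwards [h.ae_pos] with y hy
    have hcompl : MeasurableSet {x | N y ≤ N x} := h.measurable measurableSet_Ici
    have h1 : ∫⁻ x, K x y ^ s ∂μ ≤ g y ^ s * (ENNReal.ofReal k₂ * powerWeight N (-(A / p)) y) := by
      calc ∫⁻ x, K x y ^ s ∂μ
          ≤ ∫⁻ x, {x | N y ≤ N x}.indicator (fun x ↦ g y ^ s * powerWeight N γ x) x ∂μ := by
            refine lintegral_mono fun x ↦ ?_
            by_cases hxy : N y < N x
            · have hyx : x ∈ {x | N y ≤ N x} := hxy.le
              have hyx' : y ∈ {y | N y < N x} := hxy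
              simp only [hK, indicator_of_mem hyx, indicator_of_mem hyx']
              rw [ENNReal.mul_rpow_of_nonneg _ _ hs0.le, powerWeight_rpow (hy.trans hxy),
                div_mul_cancel₀ _ hs0.ne']
            · have hyx' : y ∉ {y | N y < N x} := hxy
              simp [hK, indicator_of_notMem hyx', hs0]
        _ = g y ^ s * ∫⁻ x in {x | N y ≤ N x}, powerWeight N γ x ∂μ := by
            rw [lintegral_indicator hcompl, lintegral_const_mul _ (hm γ)]
        _ = _ := by
            have hneg : γ + Q < 0 := by rw [hγQ]; exact neg_neg_of_pos (by positivity)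
            have := h.lintegral_compl_ball_rpow hneg hy
            simp only [powerWeight]
            rw [this, hγQ, abs_neg, abs_of_pos (by positivity),
              ← ENNReal.ofReal_mul (by positivity)]
            congr 3
            rw [hk₂]
            field_simp
    calc (∫⁻ x, K x y ^ s ∂μ) ^ (1 / s)
        ≤ (g y ^ s * (ENNReal.ofReal k₂ * powerWeight N (-(A / p)) y)) ^ (1 / s) := by gcongr
      _ = _ := by
          rw [ENNReal.mul_rpow_of_nonneg (g y ^ s) _ (by positivity),
            ENNReal.mul_rpow_of_nonneg (ENNReal.ofReal k₂) _ (by positivity),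
            ← ENNReal.rpow_mul (g y), mul_one_div_cancel hs0.ne', ENNReal.rpow_one,
            powerWeight_rpow hy, hgdef]
          -- By the balance condition, the extra weight introduced by Hölder's inequality cancels
          -- against the tail, leaving `|y| ^ β`.
          have e1 : β + B / p' + -(A / p) * (1 / s) = β := by
            rw [hBA, hs]; field_simp; ring
          calc F y ^ p * powerWeight N (β + B / p') y
                * (ENNReal.ofReal k₂ ^ (1 / s) * powerWeight N (-(A / p) * (1 / s)) y)
              = ENNReal.ofReal k₂ ^ (1 / s) * (F y ^ p * (powerWeight N (β + B / p') y
                * powerWeight N (-(A / p) * (1 / s)) y)) := by ring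
            _ = _ := by rw [powerWeight_mul hy, e1]
  have hmain : ∫⁻ x, (∫⁻ y in {y | N y < N x}, F y ∂μ) ^ q * powerWeight N α x ∂μ
      ≤ ENNReal.ofReal k₁ ^ (1 / p' * q) * (ENNReal.ofReal k₂ * Φ ^ s) := by
    calc ∫⁻ x, (∫⁻ y in {y | N y < N x}, F y ∂μ) ^ q * powerWeight N α x ∂μ
        ≤ ∫⁻ x, ENNReal.ofReal k₁ ^ (1 / p' * q) * (∫⁻ y, K x y ∂μ) ^ s ∂μ :=
          lintegral_mono_ae hstep
      _ = ENNReal.ofReal k₁ ^ (1 / p' * q) * ∫⁻ x, (∫⁻ y, K x y ∂μ) ^ s ∂μ :=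
          lintegral_const_mul _ (hKm.lintegral_prod_right.pow_const s)
      _ ≤ ENNReal.ofReal k₁ ^ (1 / p' * q) * (∫⁻ y, (∫⁻ x, K x y ^ s ∂μ) ^ (1 / s) ∂μ) ^ s := by
          gcongr
          exact lintegral_lintegral_rpow_le μ μ hKm hs1
      _ ≤ ENNReal.ofReal k₁ ^ (1 / p' * q) * (∫⁻ y, ENNReal.ofReal k₂ ^ (1 / s)
            * (F y ^ p * powerWeight N β y) ∂μ) ^ s := by
          gcongr 2
          exact lintegral_mono_ae hcol
      _ = _ := by
          rw [lintegral_const_mul (f := fun y ↦ F y ^ p * powerWeight N β y) _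
              ((hF.pow_const p).mul (hm β)),
            ENNReal.mul_rpow_of_nonneg _ _ hs0.le, ← ENNReal.rpow_mul, one_div_mul_cancel hs0.ne',
            ENNReal.rpow_one]
  have hC : p' ^ (1 / p') * p ^ (1 / q) * (σ ^ (1 / q + 1 / p') / (A ^ (1 / q) * B ^ (1 / p')))
      = k₁ ^ (1 / p') * k₂ ^ (1 / q) := by
    rw [hk₁, hk₂, Real.div_rpow (by positivity) hB.le, Real.div_rpow (by positivity) hA'.le,
      Real.mul_rpow hσ.le hp'.le, Real.mul_rpow hσ.le hp.le, Real.rpow_add hσ]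
    field_simp
  rw [hC, ENNReal.ofReal_mul (by positivity), ← ENNReal.ofReal_rpow_of_pos hk₁0,
    ← ENNReal.ofReal_rpow_of_pos hk₂0]
  refine (ENNReal.rpow_le_rpow hmain (by positivity : 0 ≤ 1 / q)).trans (le_of_eq ?_)
  rw [ENNReal.mul_rpow_of_nonneg _ _ (by positivity), ENNReal.mul_rpow_of_nonneg _ _ (by positivity),
    ← ENNReal.rpow_mul, ← ENNReal.rpow_mul, hs]
  have e1 : 1 / p' * q * (1 / q) = 1 / p' := by field_simp
  have e2 : q / p * (1 / q) = 1 / p := by field_simp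
  rw [e1, e2, mul_assoc]
  rfl

end IsRadialGauge

/-! ### Necessity of the conditions and the lower bound. -/

lemma eq_zero_of_forall_mul_rpow_le {k C e : ℝ} (hk : 0 < k)
    (h : ∀ R, 0 < R → k * R ^ e ≤ C) : e = 0 := by
  by_contra he
  have hC : 0 < C := by
    have := h 1 one_pos
    rw [Real.one_rpow, mul_one] at this
    exact hk.trans_le this
  have hM : 0 < (C + 1) / k := by positivity
  -- This radius makes the left side equal to `C + 1`.
  have := h (((C + 1) / k) ^ e⁻¹) (by positivity)
  rw [← Real.rpow_mul hM.le, inv_mul_cancel₀ he, Real.rpow_one, mul_div_cancel₀ _ hk.ne'] at this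
  linarith

namespace IsRadialGauge

variable {X : Type*} [MeasurableSpace X] {μ : Measure X} {N : X → ℝ} {Q σ : ℝ}

lemma lintegral_annulus_ne_top (h : IsRadialGauge μ N Q σ) (b : ℝ) {ε R : ℝ} (hε : 0 < ε) :
    ∫⁻ x in {x | ε ≤ N x ∧ N x < R}, powerWeight N b x ∂μ ≠ ⊤ := by
  rcases le_or_gt R 0 with hR | hR
  · have : {x | ε ≤ N x ∧ N x < R} = ∅ := by
      ext x
      simp only [mem_ofPred_eq, mem_empty_iff_false, iff_false, not_and, not_lt]
      exact fun _ ↦ hR.trans (h.nonneg x)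
    simp [this]
  have hle : ∀ x ∈ {x | ε ≤ N x ∧ N x < R},
      powerWeight N b x ≤ ENNReal.ofReal (max (ε ^ b) (R ^ b)) := by
    rintro x ⟨h1, h2⟩
    refine ENNReal.ofReal_le_ofReal ?_
    rcases le_total 0 b with hb | hb
    · exact (Real.rpow_le_rpow (h.nonneg x) h2.le hb).trans (le_max_right _ _)
    · exact (Real.rpow_le_rpow_of_nonpos hε h1 hb).trans (le_max_left _ _)
  have hms : MeasurableSet {x | ε ≤ N x ∧ N x < R} := h.measurable measurableSet_Ico
  refine ((setLIntegral_mono' hms hle).trans_lt ?_).ne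
  rw [setLIntegral_const]
  refine ENNReal.mul_lt_top ENNReal.ofReal_lt_top ?_
  refine (measure_mono fun x (hx : _ ∧ _) ↦ (hx.2 : x ∈ {x | N x < R})).trans_lt ?_
  rw [h.measure_ball R hR]
  exact ENNReal.ofReal_lt_top

/-- The Hardy inequality tested on a truncated power of `|x|`. -/
lemma annulus_le_of_hardyInequality (h : IsRadialGauge μ N Q σ) {p p' q α β C : ℝ}
    (hpp' : p.HolderConjugate p') (hq : 0 < q) (hH : HardyInequality μ N p q α β C)
    {ε R : ℝ} (hε : 0 < ε) :
    (∫⁻ x in {x | ε ≤ N x ∧ N x < R}, powerWeight N (β * (1 - p')) x ∂μ) ^ (1 / p')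
      * (∫⁻ x in {x | R ≤ N x}, powerWeight N α x ∂μ) ^ (1 / q) ≤ ENNReal.ofReal C := by
  have hp := hpp'.pos
  have hp' := hpp'.symm.pos
  have hinv := hpp'.inv_add_inv_eq_one
  set b := β * (1 - p') with hb
  have hbp : b * p + β = b := by
    have : p + p' = p * p' := by
      have := congrArg (fun z ↦ p * p' * z) hinv
      field_simp at this
      linarith
    rw [hb]
    linear_combination β * this
  set S := {x | ε ≤ N x ∧ N x < R} with hS
  have hSm : MeasurableSet S := h.measurable measurableSet_Ico
  have hcm : MeasurableSet {x | R ≤ N x} := h.measurable measurableSet_Ici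
  set I := ∫⁻ x in S, powerWeight N b x ∂μ with hI
  set U := ∫⁻ x in {x | R ≤ N x}, powerWeight N α x ∂μ with hU
  -- Staying away from the origin keeps `I` finite, so `I ^ (1 / p)` can be cancelled at the end.
  have hIt : I ≠ ⊤ := h.lintegral_annulus_ne_top b hε
  rcases eq_or_ne I 0 with hI0 | hI0
  · rw [hI0, ENNReal.zero_rpow_of_pos (by positivity), zero_mul]
    exact zero_le
  -- With `b = β (1 - p')` one has `b p + β = b`, so the norm on the right and the inner integral on
  -- the left involve the same `I`.
  set f : X → ℂ := S.indicator fun x ↦ ((N x ^ b : ℝ) : ℂ) with hf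
  have hfm : Measurable f :=
    (Complex.measurable_ofReal.comp (h.measurable.pow_const b)).indicator hSm
  have hfe : ∀ x, ‖f x‖ₑ = S.indicator (powerWeight N b) x := by
    intro x
    by_cases hx : x ∈ S
    · have hNx : 0 ≤ N x ^ b := Real.rpow_nonneg (h.nonneg x) b
      simp only [hf, indicator_of_mem hx, powerWeight]
      rw [← ofReal_norm, Complex.norm_real, Real.norm_of_nonneg hNx]
    · simp [hf, indicator_of_notMem hx]
  have hHf := hH f hfm
  have hright : ∫⁻ x, ‖f x‖ₑ ^ p * ENNReal.ofReal (N x ^ β) ∂μ = I := by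
    rw [hI, ← lintegral_indicator hSm]
    refine lintegral_congr fun x ↦ ?_
    rw [hfe]
    by_cases hx : x ∈ S
    · have hNx : 0 < N x := hε.trans_le hx.1
      simp only [indicator_of_mem hx]
      rw [powerWeight_rpow hNx]
      exact (powerWeight_mul hNx _ _).trans (by rw [hbp])
    · simp [indicator_of_notMem hx, hp]
  have hleft : I ^ q * U ≤ ∫⁻ x, (∫⁻ y in {y | N y < N x}, ‖f y‖ₑ ∂μ) ^ q
      * ENNReal.ofReal (N x ^ α) ∂μ := by
    calc I ^ q * U = ∫⁻ x in {x | R ≤ N x}, I ^ q * powerWeight N α x ∂μ := by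
          rw [lintegral_const_mul _ (measurable_powerWeight h.measurable α)]
      _ ≤ ∫⁻ x in {x | R ≤ N x}, (∫⁻ y in {y | N y < N x}, ‖f y‖ₑ ∂μ) ^ q
            * ENNReal.ofReal (N x ^ α) ∂μ := by
          refine setLIntegral_mono' hcm fun x (hx : R ≤ N x) ↦ ?_
          have hsub : S ⊆ {y | N y < N x} := fun y hy ↦ lt_of_lt_of_le hy.2 hx
          have hle : I ≤ ∫⁻ y in {y | N y < N x}, ‖f y‖ₑ ∂μ := by
            simp_rw [hfe]
            rw [lintegral_indicator hSm, Measure.restrict_restrict hSm, inter_eq_left.2 hsub]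
          exact mul_le_mul' (ENNReal.rpow_le_rpow hle hq.le) le_rfl
      _ ≤ _ := setLIntegral_le_lintegral _ _
  rw [hright] at hHf
  have hmain : I * U ^ (1 / q) ≤ ENNReal.ofReal C * I ^ (1 / p) := by
    refine le_trans (le_of_eq ?_) ((ENNReal.rpow_le_rpow hleft (by positivity)).trans hHf)
    rw [ENNReal.mul_rpow_of_nonneg _ _ (by positivity), ← ENNReal.rpow_mul,
      mul_one_div_cancel hq.ne', ENNReal.rpow_one]
  have hsplit : I = I ^ (1 / p) * I ^ (1 / p') := by
    rw [← ENNReal.rpow_add _ _ hI0 hIt, one_div, one_div, hinv, ENNReal.rpow_one]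
  have hne0 : I ^ (1 / p) ≠ 0 := by simp [ENNReal.rpow_eq_zero_iff, hI0, hIt]
  have hnet : I ^ (1 / p) ≠ ⊤ := ENNReal.rpow_ne_top_of_nonneg (by positivity) hIt
  rw [← ENNReal.mul_le_mul_iff_right hne0 hnet, ← mul_assoc, ← hsplit, mul_comm _ (ENNReal.ofReal C)]
  exact hmain

/-- Positivity excludes `0 * ∞`: a bounded product of the two factors then forces each of them to be
finite. -/
lemma ball_powerWeight_ne_zero (h : IsRadialGauge μ N Q σ) (b : ℝ) {R : ℝ} (hR : 0 < R) :
    ∫⁻ x in {x | 0 < N x ∧ N x < R}, powerWeight N b x ∂μ ≠ 0 := by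
  have h1 : {x | 0 < N x ∧ N x < R} = N ⁻¹' Ioo 0 R := rfl
  have hσ := h.area_pos
  simp only [powerWeight]
  rw [h1, h.setLIntegral_rpow measurableSet_Ioo,
    (inter_eq_left.2 fun x hx ↦ hx.1 : Ioo 0 R ∩ Ioi 0 = Ioo 0 R)]
  refine (setLIntegral_pos_iff (by fun_prop) |>.2 ?_).ne'
  refine lt_of_lt_of_le ?_ (measure_mono (?_ : Ioo 0 R ⊆ _))
  · simpa using hR
  · intro r hr
    have : 0 < r := hr.1
    refine ⟨?_, hr⟩
    simp only [Function.mem_support, ne_eq, ENNReal.ofReal_eq_zero, not_le]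
    positivity

lemma compl_ball_powerWeight_ne_zero (h : IsRadialGauge μ N Q σ) (a : ℝ) {R : ℝ} (hR : 0 < R) :
    ∫⁻ x in {x | R ≤ N x}, powerWeight N a x ∂μ ≠ 0 := by
  have h1 : {x | R ≤ N x} = N ⁻¹' Ici R := rfl
  have hσ := h.area_pos
  simp only [powerWeight]
  rw [h1, h.setLIntegral_rpow measurableSet_Ici,
    (inter_eq_left.2 fun x hx ↦ hR.trans_le hx : Ici R ∩ Ioi 0 = Ici R)]
  refine (setLIntegral_pos_iff (by fun_prop) |>.2 ?_).ne'
  refine lt_of_lt_of_le ?_ (measure_mono (?_ : Ici R ⊆ _))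
  · simp
  · intro r hr
    have : 0 < r := hR.trans_le hr
    refine ⟨?_, hr⟩
    simp only [Function.mem_support, ne_eq, ENNReal.ofReal_eq_zero, not_le]
    positivity

lemma ball_le_of_hardyInequality (h : IsRadialGauge μ N Q σ) {p p' q α β C : ℝ}
    (hpp' : p.HolderConjugate p') (hq : 0 < q) (hH : HardyInequality μ N p q α β C)
    {R : ℝ} (hR : 0 < R) :
    (∫⁻ x in {x | 0 < N x ∧ N x < R}, powerWeight N (β * (1 - p')) x ∂μ) ^ (1 / p')
      * (∫⁻ x in {x | R ≤ N x}, powerWeight N α x ∂μ) ^ (1 / q) ≤ ENNReal.ofReal C := by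
  set b := β * (1 - p') with hb
  set T : ℕ → Set X := fun n ↦ {x | 1 / ((n : ℝ) + 1) ≤ N x ∧ N x < R} with hT
  have hTm : ∀ n, MeasurableSet (T n) := fun n ↦ h.measurable measurableSet_Ico
  have hmono : Monotone T := fun m n hmn x hx ↦
    ⟨(one_div_le_one_div_of_le (by positivity) (by gcongr)).trans hx.1, hx.2⟩
  have hunion : ⋃ n, T n = {x | 0 < N x ∧ N x < R} := by
    ext x
    simp only [hT, mem_iUnion, mem_ofPred_eq]
    constructor
    · rintro ⟨n, hn, hx⟩
      exact ⟨lt_of_lt_of_le (by positivity) hn, hx⟩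
    · rintro ⟨h0, hx⟩
      obtain ⟨n, hn⟩ := exists_nat_one_div_lt h0
      exact ⟨n, hn.le, hx⟩
  have hlim := tendsto_measure_iUnion_atTop (μ := μ.withDensity (powerWeight N b)) hmono
  have hSm : MeasurableSet {x | 0 < N x ∧ N x < R} := h.measurable measurableSet_Ioo
  rw [hunion, withDensity_apply _ hSm] at hlim
  -- The other factor might still be infinite, and multiplication by `∞` is continuous only away
  -- from `0`.
  have hne : (∫⁻ x in {x | 0 < N x ∧ N x < R}, powerWeight N b x ∂μ) ^ (1 / p') ≠ 0 := by
    rw [Ne, ENNReal.rpow_eq_zero_iff_of_pos (one_div_pos.2 hpp'.symm.pos)]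
    exact h.ball_powerWeight_ne_zero b hR
  refine le_of_tendsto' (ENNReal.Tendsto.mul_const
    ((ENNReal.continuous_rpow_const.tendsto _).comp hlim) (Or.inl hne)) fun n ↦ ?_
  simp only [Function.comp_apply]
  rw [withDensity_apply _ (hTm n)]
  exact h.annulus_le_of_hardyInequality hpp' hq hH (by positivity)

/-- Necessary conditions for the Hardy inequality, with the lower bound for its constant. -/
theorem of_hardyInequality (h : IsRadialGauge μ N Q σ) {p p' q α β C : ℝ}
    (hpp' : p.HolderConjugate p') (hq : 0 < q) (hC : 0 ≤ C) (hH : HardyInequality μ N p q α β C) :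
    (α + Q < 0 ∧ 0 < β * (1 - p') + Q ∧ (α + Q) / q + (β * (1 - p') + Q) / p' = 0) ∧
      σ ^ (1 / q + 1 / p') / (|α + Q| ^ (1 / q) * (β * (1 - p') + Q) ^ (1 / p')) ≤ C := by
  have hp' := hpp'.symm.pos
  have hσ := h.area_pos
  have hball := fun (R : ℝ) (hR : 0 < R) ↦ h.ball_le_of_hardyInequality hpp' hq hH hR
  have h1 := hball 1 one_pos
  have hfin : ∀ {x y : ℝ≥0∞}, x * y ≤ ENNReal.ofReal C → y ≠ 0 → x ≠ ⊤ := by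
    rintro x y hxy hy rfl
    rw [ENNReal.top_mul hy, top_le_iff] at hxy
    exact ENNReal.ofReal_ne_top hxy
  have hrp : ∀ {z : ℝ≥0∞} {e : ℝ}, 0 < e → z ^ (1 / e) ≠ ⊤ → z ≠ ⊤ := by
    rintro z e he hz rfl
    exact hz (ENNReal.top_rpow_of_pos (by positivity))
  have hrp0 : ∀ {z : ℝ≥0∞} {e : ℝ}, 0 < e → z ≠ 0 → z ^ (1 / e) ≠ 0 := by
    intro z e he hz
    rw [Ne, ENNReal.rpow_eq_zero_iff_of_pos (by positivity)]
    exact hz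
  have hA : α + Q < 0 := by
    refine h.lt_zero_of_lintegral_compl_ball_rpow_ne_top one_pos (hrp hq (hfin
      (y := (∫⁻ x in {x | 0 < N x ∧ N x < 1}, powerWeight N (β * (1 - p')) x ∂μ) ^ (1 / p')) ?_ ?_))
    · rw [mul_comm]; exact h1
    · exact hrp0 hp' (h.ball_powerWeight_ne_zero _ one_pos)
  have hB : 0 < β * (1 - p') + Q :=
    h.pos_of_lintegral_ball_rpow_ne_top one_pos
      (hrp hp' (hfin h1 (hrp0 hq (h.compl_ball_powerWeight_ne_zero _ one_pos))))
  set B := β * (1 - p') + Q with hBdef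
  have hA' : 0 < |α + Q| := abs_pos.2 hA.ne
  -- With both integrals explicit, the bound for all `R` forces the exponent of `R` to vanish.
  have hreal : ∀ R, 0 < R → (σ ^ (1 / q + 1 / p') / (|α + Q| ^ (1 / q) * B ^ (1 / p')))
      * R ^ ((α + Q) / q + B / p') ≤ C := by
    intro R hR
    have h2 := hball R hR
    have h3 : ∫⁻ x in {x | 0 < N x ∧ N x < R}, powerWeight N (β * (1 - p')) x ∂μ
        = ENNReal.ofReal (σ / B * R ^ B) := by
      rw [← h.lintegral_ball_rpow hB hR]
      refine setLIntegral_congr ?_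
      filter_upwards [h.ae_pos] with x hx
      exact propext ⟨fun hx' ↦ hx'.2, fun hx' ↦ ⟨hx, hx'⟩⟩
    have h4 : ∫⁻ x in {x | R ≤ N x}, powerWeight N α x ∂μ
        = ENNReal.ofReal (σ / |α + Q| * R ^ (α + Q)) := h.lintegral_compl_ball_rpow hA hR
    rw [h3, h4, ENNReal.ofReal_rpow_of_pos (by positivity),
      ENNReal.ofReal_rpow_of_pos (by positivity), ← ENNReal.ofReal_mul (by positivity),
      ENNReal.ofReal_le_ofReal_iff hC] at h2
    refine le_trans (le_of_eq ?_) h2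
    rw [Real.mul_rpow (by positivity) (by positivity), Real.mul_rpow (by positivity) (by positivity),
      Real.div_rpow hσ.le hB.le, Real.div_rpow hσ.le hA'.le, ← Real.rpow_mul hR.le,
      ← Real.rpow_mul hR.le, Real.rpow_add hσ, Real.rpow_add hR, mul_one_div, mul_one_div]
    field_simp
  refine ⟨⟨hA, hB, eq_zero_of_forall_mul_rpow_le (by positivity) hreal⟩, ?_⟩
  simpa using hreal 1 one_pos

end IsRadialGauge

/-- A family of constants in the Hardy inequality that is bounded away from `0` has a least
element. -/
lemma exists_isLeast_hardyInequality {G : Type*} [MeasurableSpace G] {μ : Measure G} {N : G → ℝ}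
    {p q α β D : ℝ} (hD : 0 < D)
    (hne : {C : ℝ | 0 ≤ C ∧ HardyInequality μ N p q α β C}.Nonempty)
    (hlow : ∀ C ∈ {C : ℝ | 0 ≤ C ∧ HardyInequality μ N p q α β C}, D ≤ C) :
    ∃ C, IsLeast {C : ℝ | 0 ≤ C ∧ HardyInequality μ N p q α β C} C := by
  set S := {C : ℝ | 0 ≤ C ∧ HardyInequality μ N p q α β C} with hS
  have hbdd : BddBelow S := ⟨D, hlow⟩
  have hDC : D ≤ sInf S := le_csInf hne hlow
  refine ⟨sInf S, ⟨hD.le.trans hDC, fun f hf ↦ ?_⟩, fun C hC ↦ csInf_le hbdd hC⟩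
  obtain ⟨u, -, hu, huS⟩ := exists_seq_tendsto_sInf hne hbdd
  -- If the right-hand norm is infinite, positivity of the infimum is what makes the inequality
  -- trivial; otherwise pass to the limit along a minimizing sequence.
  rcases eq_or_ne ((∫⁻ x, ‖f x‖ₑ ^ p * ENNReal.ofReal (N x ^ β) ∂μ) ^ (1 / p)) ⊤ with ht | ht
  · rw [ht, ENNReal.mul_top (by simpa using hD.trans_le hDC)]
    exact le_top
  · exact ge_of_tendsto' (ENNReal.Tendsto.mul_const (ENNReal.tendsto_ofReal hu) (Or.inr ht))
      fun n ↦ (huS n).2 f hf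

/-! ### Homogeneous groups as radial gauges, and the conclusion. -/

namespace GroupDilations

variable {E : Type*} [NormedAddCommGroup E] [NormedSpace ℝ E] [FiniteDimensional ℝ E]
  {G : Type*} [TopologicalSpace G] [T2Space G] [SecondCountableTopology G]
  [ChartedSpace E G] [Group G] [LieGroup 𝓘(ℝ, E) ∞ G] [ConnectedSpace G] [Nontrivial G]
  [MeasurableSpace G] [BorelSpace G]

/-- The cone over the unit sphere is the punctured unit ball, so the sphere has area `Q` times the
measure of the ball. -/
theorem IsQuasiNorm.isRadialGauge {D : GroupDilations E G} {N : G → ℝ} (hN : D.IsQuasiNorm N)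
    (μ : Measure G) [μ.IsHaarMeasure] :
    IsRadialGauge μ N D.homDim (D.sphereArea μ N) := by
  have hQ := D.homDim_pos
  obtain ⟨h0, ht, hball⟩ := hN.measure_ball μ
  -- The identity lies in balls whose measure is a multiple of `r ^ Q`, which tends to `0` because
  -- `Q > 0`.
  have hone : μ {(1 : G)} = 0 := by
    have hlim : Tendsto (fun r : ℝ ↦ ENNReal.ofReal (r ^ D.homDim) * μ {x | N x < 1}) (𝓝[>] 0)
        (𝓝 0) := by
      have h1 : Tendsto (fun r : ℝ ↦ r ^ D.homDim) (𝓝[>] 0) (𝓝 0) := by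
        have := (Real.continuousAt_rpow_const 0 D.homDim (Or.inr hQ.le)).tendsto
        rw [Real.zero_rpow hQ.ne'] at this
        exact this.mono_left nhdsWithin_le_nhds
      have h2 := ENNReal.Tendsto.mul_const (ENNReal.tendsto_ofReal h1) (Or.inr ht)
      simpa using h2
    refine le_antisymm (ge_of_tendsto hlim ?_) zero_le
    filter_upwards [self_mem_nhdsWithin] with r hr
    rw [← hball r hr]
    refine measure_mono ?_
    rintro _ rfl
    change N 1 < r
    rw [(hN.eq_zero_iff 1).2 rfl]
    exact hr
  have hset : {x | ∃ r ∈ Ioo (0 : ℝ) 1, ∃ y ∈ {y | N y = 1}, x = D.dil r y}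
      = {x | N x < 1} \ {1} := by
    ext x
    constructor
    · rintro ⟨r, hr, y, hy, rfl⟩
      have hNr : N (D.dil r y) = r := by
        rw [hN.dil r hr.1, show N y = 1 from hy, mul_one]
      refine ⟨by rw [mem_ofPred_eq, hNr]; exact hr.2, fun h1 ↦ ?_⟩
      rw [mem_singleton_iff.1 h1, (hN.eq_zero_iff 1).2 rfl] at hNr
      exact hr.1.ne hNr
    · rintro ⟨hx, hx1⟩
      have hpos : 0 < N x := (hN.nonneg x).lt_of_ne fun h ↦ hx1 ((hN.eq_zero_iff x).1 h.symm)
      obtain ⟨y, hy⟩ := (D.dil (N x)).surjective x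
      refine ⟨N x, ⟨hpos, hx⟩, y, ?_, hy.symm⟩
      have := hN.dil (N x) hpos y
      rw [hy] at this
      exact (mul_eq_left₀ hpos.ne').1 this.symm
  have harea : D.sphereArea μ N = D.homDim * (μ {x | N x < 1}).toReal := by
    rw [sphereArea, surfaceMeasure, hset, measure_sdiff_null hone, ENNReal.toReal_mul,
      ENNReal.toReal_ofReal hQ.le]
  have hV : 0 < (μ {x | N x < 1}).toReal := ENNReal.toReal_pos h0 ht
  refine ⟨hN.continuous.measurable, hN.nonneg, hQ, by rw [harea]; positivity, fun r hr ↦ ?_⟩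
  rw [hball r hr, harea, mul_div_cancel_left₀ _ hQ.ne', mul_comm, ENNReal.ofReal_mul hV.le,
    ENNReal.ofReal_toReal ht]

end GroupDilations

/-- `G` is a homogeneous group: a connected, simply connected Lie group with dilations `D`, of
homogeneous dimension `Q = D.homDim`; `N` is a homogeneous quasi-norm, `μ` a Haar measure. The
inequality holds with some constant iff the three conditions hold; then there is a best constant,
and it lies between the stated bounds. -/
theorem corollary3p1
    {E : Type*} [NormedAddCommGroup E] [NormedSpace ℝ E] [FiniteDimensional ℝ E]
    {G : Type*} [TopologicalSpace G] [T2Space G] [SecondCountableTopology G]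
    [ChartedSpace E G] [Group G] [LieGroup 𝓘(ℝ, E) ∞ G] [SimplyConnectedSpace G] [Nontrivial G]
    [MeasurableSpace G] [BorelSpace G]
    (D : GroupDilations E G) (N : G → ℝ) (hN : D.IsQuasiNorm N)
    (μ : Measure G) [μ.IsHaarMeasure]
    (p p' q α β : ℝ) (hp : 1 < p) (hpp' : p.HolderConjugate p') (hpq : p ≤ q) :
    ((∃ C : ℝ, 0 ≤ C ∧ HardyInequality μ N p q α β C) ↔
      (α + D.homDim < 0 ∧ 0 < β * (1 - p') + D.homDim ∧
        (α + D.homDim) / q + (β * (1 - p') + D.homDim) / p' = 0)) ∧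
    ((α + D.homDim < 0 ∧ 0 < β * (1 - p') + D.homDim ∧
        (α + D.homDim) / q + (β * (1 - p') + D.homDim) / p' = 0) →
      ∃ C : ℝ, IsLeast {C : ℝ | 0 ≤ C ∧ HardyInequality μ N p q α β C} C ∧
        D.sphereArea μ N ^ (1 / q + 1 / p') /
            (|α + D.homDim| ^ (1 / q) * (β * (1 - p') + D.homDim) ^ (1 / p')) ≤ C ∧
        C ≤ p' ^ (1 / p') * p ^ (1 / q) *
          (D.sphereArea μ N ^ (1 / q + 1 / p') /
            (|α + D.homDim| ^ (1 / q) * (β * (1 - p') + D.homDim) ^ (1 / p')))) := by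
  have hq : 0 < q := by linarith
  have hp' := hpp'.symm.pos
  have : LocallyCompactSpace G := Manifold.locallyCompact_of_finiteDimensional 𝓘(ℝ, E)
  have hrad := hN.isRadialGauge μ
  have hσ := hrad.area_pos
  have hupper := fun (hc : α + D.homDim < 0 ∧ 0 < β * (1 - p') + D.homDim ∧
      (α + D.homDim) / q + (β * (1 - p') + D.homDim) / p' = 0) ↦
    hrad.hardyInequality hpp' hpq hc.1 hc.2.1 hc.2.2
  have hpos : α + D.homDim < 0 ∧ 0 < β * (1 - p') + D.homDim ∧
      (α + D.homDim) / q + (β * (1 - p') + D.homDim) / p' = 0 →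
      0 < D.sphereArea μ N ^ (1 / q + 1 / p') /
        (|α + D.homDim| ^ (1 / q) * (β * (1 - p') + D.homDim) ^ (1 / p')) := by
    rintro ⟨hA, hB, -⟩
    have hA' : 0 < |α + D.homDim| := abs_pos.2 hA.ne
    positivity
  refine ⟨⟨fun ⟨C, hC, hH⟩ ↦ (hrad.of_hardyInequality hpp' hq hC hH).1, fun hc ↦
    ⟨_, ?_, hupper hc⟩⟩, fun hc ↦ ?_⟩
  · have := hpos hc
    positivity
  · have hlow : ∀ C ∈ {C : ℝ | 0 ≤ C ∧ HardyInequality μ N p q α β C}, _ ≤ C := fun C hC ↦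
      (hrad.of_hardyInequality hpp' hq hC.1 hC.2).2
    have hmem : _ ∈ {C : ℝ | 0 ≤ C ∧ HardyInequality μ N p q α β C} :=
      ⟨by have := hpos hc; positivity, hupper hc⟩
    obtain ⟨C, hC⟩ := exists_isLeast_hardyInequality (hpos hc) ⟨_, hmem⟩ hlow
    exact ⟨C, hC, hlow C hC.1, hC.2 hmem⟩
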